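/- Let $p$ be a prime and let $K$ be a complete discretely valued field of characteristic $0$ with residue field of characteristic $p$, with valuation ring $\mathcal{O}$, so that $K=\mathcal{O}[\frac1p]$, and with valuation $v_p$ and norm $|x|=p^{-v_p(x)}$ normalized by $v_p(p)=1$. (Equivalently, $\mathcal{O}$ is a finite totally ramified extension of a Cohen ring of a field of characteristic $p$.) Let $\Gamma_{\mathrm{an,con}}$ be the Robba ring: the ring of bidirectional series $\sum_{i\in\mathbb{Z}}x_iu^i$ with $x_i\in K$ that converge on some annulus $\eta\le|u|<1$ with $0<\eta<1$, that is, with $\liminf_{i\to-\infty}v_p(x_i)/(-i)>0$ and $\liminf_{i\to+\infty}v_p(x_i)/i\ge0$. Let $\Gamma_{\mathrm{con}}$ be its subring of series with all $x_i\in\mathcal{O}$, let $\Gamma_{\mathrm{con}}[\frac1p]\subset\Gamma_{\mathrm{an,con}}$ be obtained by inverting $p$, and let $\Gamma_{\mathrm{an},u}$ be the subring of series in $\Gamma_{\mathrm{an,con}}$ with $x_i=0$ for $i<0$. For $r>0$ let $\Gamma_{\mathrm{an},r}$ be the subring of those elements of $\Gamma_{\mathrm{an,con}}$ that converge for $p^{-r}\le|u|<1$,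 i.e. with $ri+v_p(x_i)\to\infty$ as $i\to\pm\infty$. Put $w_r(\sum x_iu^i)=\inf_i\{ri+v_p(x_i)\}$, and for a matrix let $w_r$ be the minimum of $w_r$ over its entries. Let $I$ be the $n\times n$ identity matrix. Let $A$ be an invertible $n\times n$ matrix over $\Gamma_{\mathrm{an,con}}$. (1) There exist an invertible matrix $U$ over $\Gamma_{\mathrm{an},u}$ and an invertible matrix $V$ over $\Gamma_{\mathrm{con}}[\frac1p]$ such that $A=UV$. (2) Let $r>0$ be such that $A$ has entries in $\Gamma_{\mathrm{an},r}$ and $w_r(A-I)>0$. Then there is a unique pair of matrices $U$ over $\Gamma_{\mathrm{an},u}$ and $V$ over $\Gamma_{\mathrm{con}}[\frac1p]$ such that $A=UV$, $U-I$ involves only positive powers of $u$, $V$ involves no positive powers of $u$, $w_r(U-I)>0$ and $w_r(V-I)>0$. For this pair, $V$ has entries in $\Gamma_{\mathrm{an},r}$ and is invertible over $\Gamma_{\mathrm{con}}[\frac1p]$, one has $$\min\{w_r(U-I),\,w_r(V-I)\}\ge w_r(A-I),$$ and, if $A$ is invertible over $\Gamma_{\mathrm{an},r}$ (that is, $A^{-1}$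 also has entries in $\Gamma_{\mathrm{an},r}$), then $U$ is invertible over $\Gamma_{\mathrm{an},u}$. -/

import Mathlib

open Filter Topology

noncomputable section

namespace Robba

variable {K : Type*} [NormedField K]

/-- The bidirectional series `∑ xᵢ uⁱ` converges on the circle `|u| = ρ`,
i.e. `|xᵢ| ρⁱ → 0` as `i → ±∞`. -/
def ConvAt (ρ : ℝ) (x : ℤ → K) : Prop :=
  Tendsto (fun i : ℤ => ‖x i‖ * ρ ^ i) cofinite (𝓝 0)

theorem ConvAt.add {ρ : ℝ} (hρ : 0 < ρ) {x y : ℤ → K} (hx : ConvAt ρ x) (hy : ConvAt ρ y) :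
    ConvAt ρ (x + y) := by
  have h := Tendsto.add hx hy
  rw [add_zero] at h
  refine squeeze_zero (fun i => by positivity) (fun i => ?_) h
  rw [← add_mul]
  exact mul_le_mul_of_nonneg_right (norm_add_le _ _) (zpow_pos hρ i).le

theorem ConvAt.neg {ρ : ℝ} {x : ℤ → K} (hx : ConvAt ρ x) : ConvAt ρ (-x) := by
  simpa [ConvAt] using hx

theorem ConvAt.zero (ρ : ℝ) : ConvAt ρ (0 : ℤ → K) := by
  simp [ConvAt]

theorem ConvAt.single (ρ : ℝ) : ConvAt ρ (Pi.single 0 1 : ℤ → K) := by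
  refine tendsto_const_nhds.congr' ?_
  have h : ∀ᶠ i : ℤ in cofinite, i ≠ 0 := (Set.finite_singleton (0 : ℤ)).eventually_cofinite_notMem
  filter_upwards [h] with i hi
  simp [hi]

/-- The coefficients of the product of two bidirectional series. -/
def conv (x y : ℤ → K) (n : ℤ) : K := ∑' i : ℤ, x i * y (n - i)

theorem ConvAt.prod {ρ : ℝ} {x y : ℤ → K} (hx : ConvAt ρ x) (hy : ConvAt ρ y) :
    Tendsto (fun a : ℤ × ℤ => (‖x a.1‖ * ρ ^ a.1) * (‖y a.2‖ * ρ ^ a.2)) cofinite (𝓝 0) :=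
  tendsto_mul_cofinite_nhds_zero hx hy

theorem ConvAt.conv [IsUltrametricDist K] {ρ : ℝ} (hρ : 0 < ρ) {x y : ℤ → K}
    (hx : ConvAt ρ x) (hy : ConvAt ρ y) : ConvAt ρ (conv x y) := by
  rw [ConvAt, Metric.tendsto_nhds]
  intro ε hε
  have h := (Metric.tendsto_nhds.1 (hx.prod hy)) (ε / 2) (by positivity)
  rw [eventually_cofinite] at h ⊢
  refine (h.image fun a : ℤ × ℤ => a.1 + a.2).subset ?_
  intro n hn
  by_contra hcon
  apply hn
  have key : ‖Robba.conv x y n‖ ≤ ε / 2 * ρ ^ (-n) := by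
    refine IsUltrametricDist.norm_tsum_le_of_forall_le fun i => ?_
    by_contra hi
    refine hcon ⟨(i, n - i), ?_, by simp⟩
    intro hlt
    apply hi
    rw [Real.dist_eq, sub_zero, abs_of_nonneg (by positivity)] at hlt
    have e : (‖x i‖ * ρ ^ i) * (‖y (n - i)‖ * ρ ^ (n - i)) = ‖x i * y (n - i)‖ * ρ ^ n := by
      rw [norm_mul, zpow_sub₀ hρ.ne']
      field_simp
    simp only at hlt
    rw [e] at hlt
    rw [zpow_neg, ← div_eq_mul_inv, le_div_iff₀ (zpow_pos hρ n)]
    exact hlt.le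
  rw [Real.dist_eq, sub_zero, abs_of_nonneg (by positivity)]
  rw [zpow_neg, ← div_eq_mul_inv, le_div_iff₀ (zpow_pos hρ n)] at key
  linarith

theorem summable_conv [IsUltrametricDist K] [CompleteSpace K] {ρ : ℝ} (hρ : 0 < ρ) {x y : ℤ → K}
    (hx : ConvAt ρ x) (hy : ConvAt ρ y) (n : ℤ) : Summable fun i : ℤ => x i * y (n - i) := by
  apply NonarchimedeanAddGroup.summable_of_tendsto_cofinite_zero
  rw [tendsto_zero_iff_norm_tendsto_zero]
  have hinj : Function.Injective fun i : ℤ => (i, n - i) := fun i j h => (Prod.ext_iff.1 h).1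
  have h := ((hx.prod hy).comp hinj.tendsto_cofinite).mul_const (ρ ^ (-n))
  rw [zero_mul] at h
  refine h.congr fun i => ?_
  simp only [Function.comp, norm_mul, zpow_sub₀ hρ.ne', zpow_neg]
  field_simp

theorem summable_conv₃ [IsUltrametricDist K] [CompleteSpace K] {ρ : ℝ} (hρ : 0 < ρ)
    {x y z : ℤ → K} (hx : ConvAt ρ x) (hy : ConvAt ρ y) (hz : ConvAt ρ z) (n : ℤ) :
    Summable (Function.uncurry fun i j : ℤ => x i * y (j - i) * z (n - j)) := by
  apply NonarchimedeanAddGroup.summable_of_tendsto_cofinite_zero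
  rw [tendsto_zero_iff_norm_tendsto_zero]
  have h3 := tendsto_mul_cofinite_nhds_zero (hx.prod hy) hz
  have hinj : Function.Injective fun a : ℤ × ℤ => ((a.1, a.2 - a.1), n - a.2) := by
    rintro ⟨a, b⟩ ⟨c, d⟩ h
    simp only [Prod.mk.injEq] at h
    ext
    · exact h.1.1
    · simp only; omega
  have h := (h3.comp hinj.tendsto_cofinite).mul_const (ρ ^ (-n))
  rw [zero_mul] at h
  refine h.congr ?_
  rintro ⟨i, j⟩
  simp only [Function.comp, Function.uncurry, norm_mul, zpow_sub₀ hρ.ne', zpow_neg]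
  field_simp

theorem conv_comm (x y : ℤ → K) : conv x y = conv y x := by
  funext n
  rw [conv, ← (Equiv.subLeft n).tsum_eq]
  refine tsum_congr fun i => ?_
  simp [mul_comm]

theorem conv_assoc [IsUltrametricDist K] [CompleteSpace K] {ρ : ℝ} (hρ : 0 < ρ)
    {x y z : ℤ → K} (hx : ConvAt ρ x) (hy : ConvAt ρ y) (hz : ConvAt ρ z) :
    conv (conv x y) z = conv x (conv y z) := by
  funext n
  have h1 : conv (conv x y) z n = ∑' j : ℤ, ∑' i : ℤ, x i * y (j - i) * z (n - j) := by
    simp only [conv, tsum_mul_right]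
  have h2 : conv x (conv y z) n = ∑' i : ℤ, ∑' j : ℤ, x i * y (j - i) * z (n - j) := by
    simp only [conv]
    refine tsum_congr fun i => ?_
    rw [← tsum_mul_left, ← (Equiv.subRight i).tsum_eq]
    refine tsum_congr fun j => ?_
    rw [Equiv.subRight_apply, mul_assoc]
    congr 3
    omega
  rw [h1, h2]
  exact (summable_conv₃ hρ hx hy hz n).tsum_comm

theorem single_conv (x : ℤ → K) : conv (Pi.single 0 1) x = x := by
  funext n
  rw [conv, tsum_eq_single 0]
  · simp
  · intro i hi
    simp [hi]

theorem conv_add [IsUltrametricDist K] [CompleteSpace K] {ρ : ℝ} (hρ : 0 < ρ)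
    {x y z : ℤ → K} (hx : ConvAt ρ x) (hy : ConvAt ρ y) (hz : ConvAt ρ z) :
    conv x (y + z) = conv x y + conv x z := by
  funext n
  simp only [conv, Pi.add_apply, mul_add]
  exact (summable_conv hρ hx hy n).tsum_add (summable_conv hρ hx hz n)

variable (K) in
/-- Bidirectional series over `K` that converge on some annulus `η ≤ |u| < 1`. -/
def series : AddSubgroup (ℤ → K) where
  carrier := {x | ∃ η : ℝ, 0 < η ∧ η < 1 ∧ ∀ ρ : ℝ, η ≤ ρ → ρ < 1 → ConvAt ρ x}
  add_mem' := by
    rintro x y ⟨η, h0, h1, hx⟩ ⟨θ, k0, k1, hy⟩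
    exact ⟨max η θ, lt_max_of_lt_left h0, max_lt h1 k1, fun ρ hρ hρ1 =>
      (hx ρ (le_of_max_le_left hρ) hρ1).add (h0.trans_le (le_of_max_le_left hρ))
        (hy ρ (le_of_max_le_right hρ) hρ1)⟩
  zero_mem' := ⟨1 / 2, by norm_num, by norm_num, fun ρ _ _ => ConvAt.zero ρ⟩
  neg_mem' := by
    rintro x ⟨η, h0, h1, hx⟩
    exact ⟨η, h0, h1, fun ρ hρ hρ1 => (hx ρ hρ hρ1).neg⟩

theorem one_mem_series : (Pi.single 0 1 : ℤ → K) ∈ series K :=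
  ⟨1 / 2, by norm_num, by norm_num, fun ρ _ _ => ConvAt.single ρ⟩

theorem conv_mem_series [IsUltrametricDist K] {x y : ℤ → K} (hx : x ∈ series K)
    (hy : y ∈ series K) : conv x y ∈ series K := by
  obtain ⟨η, h0, h1, hx⟩ := hx
  obtain ⟨θ, k0, k1, hy⟩ := hy
  exact ⟨max η θ, lt_max_of_lt_left h0, max_lt h1 k1, fun ρ hρ hρ1 =>
    (hx ρ (le_of_max_le_left hρ) hρ1).conv (h0.trans_le (le_of_max_le_left hρ))
      (hy ρ (le_of_max_le_right hρ) hρ1)⟩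

theorem exists_common {x y z : ℤ → K} (hx : x ∈ series K) (hy : y ∈ series K)
    (hz : z ∈ series K) : ∃ ρ : ℝ, 0 < ρ ∧ ConvAt ρ x ∧ ConvAt ρ y ∧ ConvAt ρ z := by
  obtain ⟨η, h0, h1, hx⟩ := hx
  obtain ⟨θ, k0, k1, hy⟩ := hy
  obtain ⟨κ, l0, l1, hz⟩ := hz
  have h : max η (max θ κ) < 1 := max_lt h1 (max_lt k1 l1)
  exact ⟨max η (max θ κ), lt_max_of_lt_left h0, hx _ (by simp) h, hy _ (by simp) h,
    hz _ (by simp) h⟩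

end Robba

/-- The Robba ring `Γ_{an,con}` over `K`. -/
def RobbaRing (K : Type*) [NormedField K] : Type _ := ↥(Robba.series K)

namespace RobbaRing

variable {K : Type*} [NormedField K]

/-- The coefficient of `uⁱ`. -/
def coeff (x : RobbaRing K) (i : ℤ) : K := x.1 i

instance : AddCommGroup (RobbaRing K) := inferInstanceAs (AddCommGroup ↥(Robba.series K))

instance : One (RobbaRing K) := ⟨⟨Pi.single 0 1, Robba.one_mem_series⟩⟩

theorem coeff_zero (i : ℤ) : (0 : RobbaRing K).coeff i = 0 := rfl

theorem coeff_one (i : ℤ) : (1 : RobbaRing K).coeff i = (Pi.single 0 1 : ℤ → K) i := rfl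

theorem coeff_add (x y : RobbaRing K) (i : ℤ) : (x + y).coeff i = x.coeff i + y.coeff i := rfl

theorem coeff_neg (x : RobbaRing K) (i : ℤ) : (-x).coeff i = -x.coeff i := rfl

variable [IsUltrametricDist K]

instance : Mul (RobbaRing K) := ⟨fun x y => ⟨Robba.conv x.1 y.1, Robba.conv_mem_series x.2 y.2⟩⟩

instance [CompleteSpace K] : CommRing (RobbaRing K) :=
  { (inferInstance : AddCommGroup (RobbaRing K)),
    (inferInstance : One (RobbaRing K)),
    (inferInstance : Mul (RobbaRing K)) with
    mul_assoc := fun x y z => by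
      obtain ⟨ρ, h0, hx, hy, hz⟩ := Robba.exists_common x.2 y.2 z.2
      exact Subtype.ext (Robba.conv_assoc h0 hx hy hz)
    mul_comm := fun x y => Subtype.ext (Robba.conv_comm x.1 y.1)
    one_mul := fun x => Subtype.ext (Robba.single_conv x.1)
    mul_one := fun x => Subtype.ext ((Robba.conv_comm _ _).trans (Robba.single_conv x.1))
    left_distrib := fun x y z => by
      obtain ⟨ρ, h0, hx, hy, hz⟩ := Robba.exists_common x.2 y.2 z.2
      exact Subtype.ext (Robba.conv_add h0 hx hy hz)
    right_distrib := fun x y z => by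
      obtain ⟨ρ, h0, hx, hy, hz⟩ := Robba.exists_common x.2 y.2 z.2
      refine Subtype.ext ((Robba.conv_comm _ _).trans ((Robba.conv_add h0 hz hx hy).trans ?_))
      exact congrArg₂ (· + ·) (Robba.conv_comm _ _) (Robba.conv_comm _ _)
    zero_mul := fun x => Subtype.ext (funext fun n => by
      change ∑' i : ℤ, (0 : K) * x.1 (n - i) = 0
      simp)
    mul_zero := fun x => Subtype.ext (funext fun n => by
      change ∑' i : ℤ, x.1 i * (0 : K) = 0
      simp) }

theorem coeff_mul (x y : RobbaRing K) (n : ℤ) :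
    (x * y).coeff n = ∑' i : ℤ, x.coeff i * y.coeff (n - i) := rfl

variable [CompleteSpace K]

variable (K) in
/-- `Γ_{an,u}`: the series in nonnegative powers of `u`. -/
def gammaAnU : Subring (RobbaRing K) where
  carrier := {x | ∀ i : ℤ, i < 0 → x.coeff i = 0}
  zero_mem' := fun i _ => rfl
  one_mem' := fun i hi => by rw [coeff_one]; simp [hi.ne]
  add_mem' := fun {x y} hx hy i hi => by rw [coeff_add, hx i hi, hy i hi, add_zero]
  neg_mem' := fun {x} hx i hi => by rw [coeff_neg, hx i hi, neg_zero]
  mul_mem' := fun {x y} hx hy n hn => by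
    rw [coeff_mul]
    refine (tsum_congr fun i => ?_).trans tsum_zero
    rcases lt_or_ge i 0 with hi | hi
    · rw [hx i hi, zero_mul]
    · rw [hy (n - i) (by omega), mul_zero]

variable (K) in
/-- `Γ_con`: the series in the Robba ring with coefficients in the valuation ring of `K`. -/
def gammaCon : Subring (RobbaRing K) where
  carrier := {x | ∀ i : ℤ, ‖x.coeff i‖ ≤ 1}
  zero_mem' := fun i => by rw [coeff_zero]; simp
  one_mem' := fun i => by
    rw [coeff_one]
    by_cases hi : i = 0 <;> simp [hi]
  add_mem' := fun {x y} hx hy i => by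
    rw [coeff_add]
    exact (IsUltrametricDist.norm_add_le_max _ _).trans (max_le (hx i) (hy i))
  neg_mem' := fun {x} hx i => by
    rw [coeff_neg, norm_neg]
    exact hx i
  mul_mem' := fun {x y} hx hy n => by
    rw [coeff_mul]
    refine IsUltrametricDist.norm_tsum_le_of_forall_le fun i => ?_
    rw [norm_mul]
    exact mul_le_one₀ (hx i) (norm_nonneg _) (hy _)

variable (K) in
/-- `Γ_con[1/p]`, as a subring of the Robba ring. -/
def gammaConInv (p : ℕ) : Subring (RobbaRing K) where
  carrier := {x | ∃ m : ℕ, (p : RobbaRing K) ^ m * x ∈ gammaCon K}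
  zero_mem' := ⟨0, by simp⟩
  one_mem' := ⟨0, by simp⟩
  add_mem' := by
    rintro x y ⟨m, hm⟩ ⟨l, hl⟩
    have hp : (p : RobbaRing K) ∈ gammaCon K := natCast_mem _ p
    refine ⟨m + l, ?_⟩
    have e : (p : RobbaRing K) ^ (m + l) * (x + y) =
        (p : RobbaRing K) ^ l * ((p : RobbaRing K) ^ m * x) +
          (p : RobbaRing K) ^ m * ((p : RobbaRing K) ^ l * y) := by ring
    rw [e]
    exact add_mem (mul_mem (pow_mem hp l) hm) (mul_mem (pow_mem hp m) hl)
  neg_mem' := by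
    rintro x ⟨m, hm⟩
    exact ⟨m, by rw [mul_neg]; exact neg_mem hm⟩
  mul_mem' := by
    rintro x y ⟨m, hm⟩ ⟨l, hl⟩
    refine ⟨m + l, ?_⟩
    have e : (p : RobbaRing K) ^ (m + l) * (x * y) =
        ((p : RobbaRing K) ^ m * x) * ((p : RobbaRing K) ^ l * y) := by ring
    rw [e]
    exact mul_mem hm hl

theorem rpow_pos' (p : ℕ) [Fact p.Prime] (r : ℝ) : 0 < (p : ℝ) ^ (-r) :=
  Real.rpow_pos_of_pos (Nat.cast_pos.2 (Fact.out : p.Prime).pos) _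

variable (K) in
/-- `Γ_{an,r}`: the elements of the Robba ring that converge for `p^{-r} ≤ |u| < 1`.
For an element `∑ xᵢ uⁱ` of the Robba ring this means that it converges on `|u| = p^{-r}`, i.e.
`v_p(xᵢ) + r i → ∞` as `i → ±∞`. -/
def gammaAn (p : ℕ) [Fact p.Prime] (r : ℝ) : Subring (RobbaRing K) where
  carrier := {x | Robba.ConvAt ((p : ℝ) ^ (-r)) x.coeff}
  zero_mem' := Robba.ConvAt.zero _
  one_mem' := Robba.ConvAt.single _
  add_mem' := fun hx hy => Robba.ConvAt.add (rpow_pos' p r) hx hy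
  neg_mem' := fun hx => Robba.ConvAt.neg hx
  mul_mem' := fun hx hy => Robba.ConvAt.conv (rpow_pos' p r) hx hy

end RobbaRing

/-- The valuation `v_p` on `K`, with `|a| = p ^ (-v_p(a))` and `v_p(0) = ∞`. -/
def padicVal {K : Type*} [NormedField K] (p : ℕ) (a : K) : EReal :=
  open Classical in if a = 0 then ⊤ else ((-Real.logb p ‖a‖ : ℝ) : EReal)

/-- The naive valuation `w_r(∑ xᵢ uⁱ) = inf_i (r i + v_p(xᵢ))`. -/
def naiveVal {K : Type*} [NormedField K] (p : ℕ) (r : ℝ) (x : RobbaRing K) : EReal :=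
  ⨅ i : ℤ, (((r * i : ℝ) : EReal) + padicVal p (x.coeff i))

/-- `w_r` of a matrix: the minimum over the entries. -/
def naiveValMatrix {K : Type*} [NormedField K] {n : ℕ} (p : ℕ) (r : ℝ)
    (M : Matrix (Fin n) (Fin n) (RobbaRing K)) : EReal :=
  ⨅ a : Fin n, ⨅ b : Fin n, naiveVal p r (M a b)

section Matrices

variable {K : Type*} [NormedField K] [IsUltrametricDist K] [CompleteSpace K] {n : ℕ}

/-- `M` is (the image of) an invertible matrix over the subring `S`. -/
def InvertibleOver (S : Subring (RobbaRing K))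
    (M : Matrix (Fin n) (Fin n) (RobbaRing K)) : Prop :=
  ∃ g : Matrix.GeneralLinearGroup (Fin n) S,
    (Matrix.GeneralLinearGroup.map S.subtype g : Matrix (Fin n) (Fin n) (RobbaRing K)) = M

/-- `A = U V` with `U` over `Γ_{an,u}` and `V` over `Γ_con[1/p]` such that `U - I` involves only
positive powers of `u`, `V` involves no positive powers of `u`, `w_r(U - I) > 0` and
`w_r(V - I) > 0`. -/
structure IsNormalizedFactorization (p : ℕ) (r : ℝ)
    (A U V : Matrix (Fin n) (Fin n) (RobbaRing K)) : Prop where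
  eq_mul : A = U * V
  left_mem : ∀ a b, U a b ∈ RobbaRing.gammaAnU K
  right_mem : ∀ a b, V a b ∈ RobbaRing.gammaConInv K p
  left_powers : ∀ a b, ∀ i : ℤ, i ≤ 0 → ((U - 1) a b).coeff i = 0
  right_powers : ∀ a b, ∀ i : ℤ, 0 < i → (V a b).coeff i = 0
  left_pos : 0 < naiveValMatrix p r (U - 1)
  right_pos : 0 < naiveValMatrix p r (V - 1)

end Matrices

end

/-! The proof is a nonarchimedean Birkhoff factorization on one circle $|u|=\rho$, followed by
gluing. Series converging on the circle form a complete ultrametric ring `CircleRing`, and matrices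
over it inherit a submultiplicative sup norm. Keeping only the positive powers of $u$ is a
projection $P$ of norm at most $1$ whose range and kernel are both closed under products
(`IsSplitting`). For $A=1+E$ with $\|E\|<1$, solving $P((1+x)(1+E))=0$ with $x$ in the range of $P$
is a contraction problem. Its solution gives $V=(1+x)A$ and $U=(1+x)^{-1}$, with all norm estimates
(`exists_factorization`).

To return to the Robba ring, note that $V$ and $V^{-1}$ have no positive powers, so they converge
for all $|u|\ge\rho$ and have integral coefficients. Then $U=AV^{-1}$ is a product of Robba
matrices, and on the circle it is seen to have no negative powers (`exists_robba_factorization`).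
Uniqueness compares $U^{-1}U'$ with $VV'^{-1}$. A competing $V'$ is only known to be bounded on
$|u|=\rho$, so the comparison takes place on a slightly larger circle
(`IsNormalizedFactorization.exists_circle`).

For a general invertible $A$, it suffices to find $B$, invertible over $\Gamma_{\mathrm{con}}[1/p]$
and on the circle, with $AB$ close to $1$. The value group is countable, so $\rho$ can be chosen
with no nonzero power in it. Every nonzero series then has a single dominant term and the circle
ring is a field (`isField_of_isGeneric`). A determinant $1$ matrix over it is a product of
transvections, whose parameters can be truncated to Laurent polynomials (`exists_invertible_near`).
The determinant is removed by a diagonal matrix over $\Gamma_{\mathrm{con}}[1/p]$, because units of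
the Robba ring have bounded coefficients (`exists_bound_of_mul_eq_one`). -/

noncomputable section

/-! ### The complete normed ring of series on a circle. -/

namespace Robba

variable {K : Type*} [NormedField K]

variable (K) in
/-- The bidirectional series over `K` that converge on the circle `|u| = ρ`. -/
def CircleRing (ρ : ℝ) [Fact (0 < ρ)] : Type _ := {x : ℤ → K // ConvAt ρ x}

namespace CircleRing

variable {ρ : ℝ} [hρ : Fact (0 < ρ)]

/-- The coefficient of `uⁱ`. -/
def coeff (x : CircleRing K ρ) (i : ℤ) : K := x.1 i

theorem convAt (x : CircleRing K ρ) : ConvAt ρ x.coeff := x.2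

@[ext] theorem ext {x y : CircleRing K ρ} (h : ∀ i, x.coeff i = y.coeff i) : x = y :=
  Subtype.ext (funext h)

/-- The element of the circle ring with given coefficients. -/
def mk (x : ℤ → K) (hx : ConvAt ρ x) : CircleRing K ρ := ⟨x, hx⟩

@[simp] theorem coeff_mk (x : ℤ → K) (hx : ConvAt ρ x) (i : ℤ) :
    (mk x hx : CircleRing K ρ).coeff i = x i := rfl

instance : Zero (CircleRing K ρ) := ⟨⟨0, ConvAt.zero ρ⟩⟩
instance : One (CircleRing K ρ) := ⟨⟨Pi.single 0 1, ConvAt.single ρ⟩⟩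
instance : Add (CircleRing K ρ) := ⟨fun x y => ⟨x.1 + y.1, x.2.add hρ.out y.2⟩⟩
instance : Neg (CircleRing K ρ) := ⟨fun x => ⟨-x.1, x.2.neg⟩⟩

instance : AddCommGroup (CircleRing K ρ) where
  add_assoc x y z := Subtype.ext (add_assoc x.1 y.1 z.1)
  zero_add x := Subtype.ext (zero_add x.1)
  add_zero x := Subtype.ext (add_zero x.1)
  add_comm x y := Subtype.ext (add_comm x.1 y.1)
  neg_add_cancel x := Subtype.ext (neg_add_cancel x.1)
  nsmul := nsmulRec
  zsmul := zsmulRec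

@[simp] theorem coeff_zero (i : ℤ) : (0 : CircleRing K ρ).coeff i = 0 := rfl

theorem coeff_one (i : ℤ) : (1 : CircleRing K ρ).coeff i = (Pi.single 0 1 : ℤ → K) i := rfl

@[simp] theorem coeff_add (x y : CircleRing K ρ) (i : ℤ) :
    (x + y).coeff i = x.coeff i + y.coeff i := rfl

@[simp] theorem coeff_neg (x : CircleRing K ρ) (i : ℤ) : (-x).coeff i = -x.coeff i := rfl

@[simp] theorem coeff_sub (x y : CircleRing K ρ) (i : ℤ) :
    (x - y).coeff i = x.coeff i - y.coeff i := by
  rw [sub_eq_add_neg, coeff_add, coeff_neg, sub_eq_add_neg]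

/-- The supremum norm on the circle `|u| = ρ`. -/
instance : Norm (CircleRing K ρ) := ⟨fun x => ⨆ i : ℤ, ‖x.coeff i‖ * ρ ^ i⟩

theorem norm_coeff_mul_le (x : CircleRing K ρ) (i : ℤ) : ‖x.coeff i‖ * ρ ^ i ≤ ‖x‖ :=
  le_ciSup (f := fun i : ℤ => ‖x.coeff i‖ * ρ ^ i)
    (Tendsto.bddAbove_range_of_cofinite x.2) i

theorem norm_le_iff {x : CircleRing K ρ} {C : ℝ} :
    ‖x‖ ≤ C ↔ ∀ i, ‖x.coeff i‖ * ρ ^ i ≤ C :=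
  ⟨fun h i => (norm_coeff_mul_le x i).trans h, fun h => ciSup_le h⟩

theorem norm_coeff_le (x : CircleRing K ρ) (i : ℤ) : ‖x.coeff i‖ ≤ ‖x‖ * ρ ^ (-i) := by
  rw [zpow_neg, ← div_eq_mul_inv, le_div_iff₀ (zpow_pos hρ.out i)]
  exact norm_coeff_mul_le x i

theorem norm_nonneg' (x : CircleRing K ρ) : 0 ≤ ‖x‖ :=
  le_trans (by have := zpow_pos hρ.out 0; positivity) (norm_coeff_mul_le x 0)

instance : NormedAddCommGroup (CircleRing K ρ) :=
  AddGroupNorm.toNormedAddCommGroup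
    { toFun := fun x => ‖x‖
      map_zero' := le_antisymm (norm_le_iff.2 fun i => by simp) (norm_nonneg' 0)
      add_le' := fun x y => norm_le_iff.2 fun i => by
        refine le_trans ?_ (add_le_add (norm_coeff_mul_le x i) (norm_coeff_mul_le y i))
        rw [← add_mul]
        exact mul_le_mul_of_nonneg_right (norm_add_le _ _) (zpow_pos hρ.out i).le
      neg' := fun x => by
        change (⨆ i : ℤ, _) = ⨆ i : ℤ, _
        simp
      eq_zero_of_map_eq_zero' := fun x hx => by
        ext i
        have h := norm_coeff_le x i
        rw [hx, zero_mul] at h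
        exact norm_le_zero_iff.1 h }

variable [IsUltrametricDist K]

instance : IsUltrametricDist (CircleRing K ρ) :=
  IsUltrametricDist.isUltrametricDist_of_forall_norm_add_le_max_norm fun x y =>
    norm_le_iff.2 fun i => by
      refine le_trans ?_ (max_le_max (norm_coeff_mul_le x i) (norm_coeff_mul_le y i))
      rw [← max_mul_of_nonneg _ _ (zpow_pos hρ.out i).le]
      exact mul_le_mul_of_nonneg_right (IsUltrametricDist.norm_add_le_max _ _)
        (zpow_pos hρ.out i).le

instance : Mul (CircleRing K ρ) := ⟨fun x y => ⟨conv x.1 y.1, x.2.conv hρ.out y.2⟩⟩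

theorem coeff_mul (x y : CircleRing K ρ) (n : ℤ) :
    (x * y).coeff n = ∑' i : ℤ, x.coeff i * y.coeff (n - i) := rfl

theorem norm_mul_le' (x y : CircleRing K ρ) : ‖x * y‖ ≤ ‖x‖ * ‖y‖ := by
  refine norm_le_iff.2 fun n => ?_
  rw [← le_div_iff₀ (zpow_pos hρ.out n), coeff_mul]
  refine IsUltrametricDist.norm_tsum_le_of_forall_le fun i => ?_
  rw [le_div_iff₀ (zpow_pos hρ.out n), norm_mul]
  have e : ρ ^ n = ρ ^ i * ρ ^ (n - i) := by
    rw [← zpow_add₀ hρ.out.ne']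
    congr 1
    omega
  calc ‖x.coeff i‖ * ‖y.coeff (n - i)‖ * ρ ^ n
      = (‖x.coeff i‖ * ρ ^ i) * (‖y.coeff (n - i)‖ * ρ ^ (n - i)) := by rw [e]; ring
    _ ≤ ‖x‖ * ‖y‖ := mul_le_mul (norm_coeff_mul_le x i) (norm_coeff_mul_le y _)
        (mul_nonneg (norm_nonneg _) (zpow_pos hρ.out _).le) (norm_nonneg _)

variable [CompleteSpace K]

instance : CommRing (CircleRing K ρ) :=
  { (inferInstance : AddCommGroup (CircleRing K ρ)),
    (inferInstance : One (CircleRing K ρ)),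
    (inferInstance : Mul (CircleRing K ρ)) with
    mul_assoc := fun x y z => Subtype.ext (conv_assoc hρ.out x.2 y.2 z.2)
    mul_comm := fun x y => Subtype.ext (conv_comm x.1 y.1)
    one_mul := fun x => Subtype.ext (single_conv x.1)
    mul_one := fun x => Subtype.ext ((conv_comm _ _).trans (single_conv x.1))
    left_distrib := fun x y z => Subtype.ext (conv_add hρ.out x.2 y.2 z.2)
    right_distrib := fun x y z =>
      Subtype.ext ((conv_comm _ _).trans ((conv_add hρ.out z.2 x.2 y.2).trans
        (congrArg₂ (· + ·) (conv_comm _ _) (conv_comm _ _))))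
    zero_mul := fun x => Subtype.ext (funext fun n => by
      change ∑' i : ℤ, (0 : K) * x.1 (n - i) = 0
      simp)
    mul_zero := fun x => Subtype.ext (funext fun n => by
      change ∑' i : ℤ, x.1 i * (0 : K) = 0
      simp) }

instance : NormedCommRing (CircleRing K ρ) :=
  { (inferInstance : CommRing (CircleRing K ρ)),
    (inferInstance : NormedAddCommGroup (CircleRing K ρ)) with
    norm_mul_le := norm_mul_le' }

instance : NormOneClass (CircleRing K ρ) := ⟨le_antisymm
  (norm_le_iff.2 fun i => by
    by_cases hi : i = 0 <;> simp [coeff_one, hi])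
  (by simpa [coeff_one] using norm_coeff_mul_le (1 : CircleRing K ρ) 0)⟩

/-- Limits are taken coefficientwise. The Cauchy estimate passes to the limit uniformly in the
index, and this uniformity gives both the decay of the limit series and convergence in norm. -/
instance : CompleteSpace (CircleRing K ρ) := by
  refine Metric.complete_of_cauchySeq_tendsto fun f hf => ?_
  have hpos : ∀ i : ℤ, 0 < ρ ^ i := fun i => zpow_pos hρ.out i
  have hcoeff : ∀ i, CauchySeq fun m => (f m).coeff i := fun i => by
    rw [Metric.cauchySeq_iff'] at hf ⊢
    intro ε hε
    obtain ⟨N, hN⟩ := hf (ε * ρ ^ i) (mul_pos hε (hpos i))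
    refine ⟨N, fun m hm => ?_⟩
    have h := (norm_coeff_mul_le (f m - f N) i).trans_lt (by simpa [dist_eq_norm] using hN m hm)
    rw [dist_eq_norm, ← coeff_sub]
    exact lt_of_mul_lt_mul_right h (hpos i).le
  choose g hg using fun i => cauchySeq_tendsto_of_complete (hcoeff i)
  have key : ∀ ε > 0, ∃ N, ∀ m ≥ N, ∀ i, ‖(f m).coeff i - g i‖ * ρ ^ i ≤ ε := fun ε hε => by
    obtain ⟨N, hN⟩ := Metric.cauchySeq_iff.1 hf ε hε
    refine ⟨N, fun m hm i => ?_⟩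
    refine le_of_tendsto (((hg i).const_sub ((f m).coeff i)).norm.mul_const (ρ ^ i)) ?_
    filter_upwards [eventually_ge_atTop N] with l hl
    rw [← coeff_sub]
    refine (norm_coeff_mul_le _ i).trans ?_
    rw [← dist_eq_norm]
    exact (hN m hm l hl).le
  have hconv : ConvAt ρ g := by
    rw [ConvAt, Metric.tendsto_nhds]
    intro ε hε
    obtain ⟨N, hN⟩ := key (ε / 2) (half_pos hε)
    filter_upwards [(Metric.tendsto_nhds.1 (f N).convAt) (ε / 2) (half_pos hε)] with i hi
    rw [Real.dist_eq, sub_zero, abs_of_nonneg (mul_nonneg (norm_nonneg _) (hpos i).le)] at hi ⊢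
    have h := hN N le_rfl i
    have h2 : ‖g i‖ ≤ ‖(f N).coeff i‖ + ‖(f N).coeff i - g i‖ := by
      rw [← norm_neg ((f N).coeff i - g i), neg_sub]
      exact norm_le_insert' _ _
    nlinarith [mul_le_mul_of_nonneg_right h2 (hpos i).le]
  refine ⟨mk g hconv, Metric.tendsto_atTop.2 fun ε hε => ?_⟩
  obtain ⟨N, hN⟩ := key (ε / 2) (half_pos hε)
  refine ⟨N, fun m hm => ?_⟩
  rw [dist_eq_norm]
  exact (norm_le_iff.2 fun i => by simpa using hN m hm i).trans_lt (half_lt_self hε)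

end CircleRing

/-! ### The ultrametric sup norm on matrices. -/

section MatrixNorm

variable {n R : Type*} [Fintype n] [DecidableEq n] [NormedCommRing R] [IsUltrametricDist R]

attribute [local instance] Matrix.normedAddCommGroup

/-- Over an ultrametric ring, the supremum norm on matrices is submultiplicative. -/
@[reducible] def matrixNormedRing : NormedRing (Matrix n n R) :=
  { (Matrix.normedAddCommGroup : NormedAddCommGroup (Matrix n n R)),
    (inferInstance : Ring (Matrix n n R)) with
    norm_mul_le := fun A B => by
      refine (Matrix.norm_le_iff (by positivity)).2 fun i j => ?_
      rw [Matrix.mul_apply]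
      refine IsUltrametricDist.norm_sum_le_of_forall_le_of_nonneg (by positivity) fun k _ => ?_
      exact (norm_mul_le _ _).trans (mul_le_mul (Matrix.norm_entry_le_entrywise_sup_norm A)
        (Matrix.norm_entry_le_entrywise_sup_norm B) (norm_nonneg _) (norm_nonneg _)) }

attribute [local instance] matrixNormedRing

instance matrix_isUltrametricDist : IsUltrametricDist (Matrix n n R) :=
  inferInstanceAs (IsUltrametricDist (n → n → R))

instance matrix_completeSpace [CompleteSpace R] :
    @CompleteSpace (Matrix n n R)
      (matrixNormedRing (n := n) (R := R)).toPseudoMetricSpace.toUniformSpace :=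
  inferInstanceAs (CompleteSpace (n → n → R))

end MatrixNorm

end Robba

/-! ### Factorization near 1 in an abstract ring with a splitting. -/

namespace Robba

/-- A projection of norm at most `1` on an ultrametric normed ring that kills `1` and whose
range and kernel are closed under multiplication. -/
structure IsSplitting {S : Type*} [NormedRing S] (P : S →+ S) : Prop where
  idem : ∀ x, P (P x) = P x
  norm_le : ∀ x, ‖P x‖ ≤ ‖x‖
  map_one : P 1 = 0
  range_mul : ∀ x y, P x = x → P y = y → P (x * y) = x * y
  ker_mul : ∀ x y, P x = 0 → P y = 0 → P (x * y) = 0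

section Ultrametric

variable {S : Type*} [NormedRing S]

theorem eq_zero_of_norm_le_mul {a : S} {c : ℝ} (hc : c < 1) (h : ‖a‖ ≤ c * ‖a‖) : a = 0 := by
  by_contra ha
  have := norm_pos_iff.2 ha
  nlinarith

variable [IsUltrametricDist S]

-- A self-referential estimate: since $\|z\|<1$, the second term can dominate only if $x=0$.
omit [IsUltrametricDist S] in
theorem norm_le_of_eq_add_mul {x y z : S} (hz : ‖z‖ < 1) {c : ℝ} (hy : ‖y‖ ≤ c)
    (h : ‖x‖ ≤ max ‖y‖ (‖x‖ * ‖z‖)) : ‖x‖ ≤ c := by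
  rcases le_max_iff.1 h with h | h
  · exact h.trans hy
  · have h0 : x = 0 := eq_zero_of_norm_le_mul hz (by rwa [mul_comm] at h)
    rw [h0, norm_zero]
    exact (norm_nonneg _).trans hy

theorem norm_mul_one_add_sub_one_le {x y : S} {c : ℝ} (hc : c ≤ 1) (hx : ‖x‖ ≤ c)
    (hy : ‖y‖ ≤ c) : ‖(1 + x) * (1 + y) - 1‖ ≤ c := by
  have e : (1 + x) * (1 + y) - 1 = x + (y + x * y) := by noncomm_ring
  rw [e]
  refine (IsUltrametricDist.norm_add_le_max _ _).trans (max_le hx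
    ((IsUltrametricDist.norm_add_le_max _ _).trans (max_le hy ?_)))
  refine (norm_mul_le _ _).trans ?_
  nlinarith [norm_nonneg x, norm_nonneg y]

/-- From $y-1=-x-x(y-1)$, where the last term is strictly smaller than $y-1$ unless $y=1$. -/
theorem norm_inverse_sub_one_le {x y : S} (hx : ‖x‖ < 1) (h : (1 + x) * y = 1) :
    ‖y - 1‖ ≤ ‖x‖ := by
  have e : y - 1 = -x + -(x * (y - 1)) := by
    have : y = 1 - x * y := by rw [← h]; noncomm_ring
    calc y - 1 = (1 - x * y) - 1 := by rw [← this]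
      _ = _ := by noncomm_ring
  refine norm_le_of_eq_add_mul (y := -x) hx (norm_neg x).le ?_
  conv_lhs => rw [e]
  refine (IsUltrametricDist.norm_add_le_max _ _).trans (max_le_max le_rfl ?_)
  rw [norm_neg, mul_comm]
  exact norm_mul_le _ _

theorem norm_sub_le_max (x y : S) : ‖x - y‖ ≤ max ‖x‖ ‖y‖ := by
  rw [sub_eq_add_neg, ← norm_neg y]
  exact IsUltrametricDist.norm_add_le_max _ _

omit [IsUltrametricDist S] in
theorem isUnit_one_add [CompleteSpace S] {x : S} (hx : ‖x‖ < 1) : IsUnit (1 + x) := by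
  simpa using isUnit_one_sub_of_norm_lt_one (x := -x) (by rwa [norm_neg])

namespace IsSplitting

variable {P : S →+ S} (hP : IsSplitting P)

include hP

theorem norm_sub_le (x : S) : ‖x - P x‖ ≤ ‖x‖ :=
  (norm_sub_le_max _ _).trans (max_le le_rfl (hP.norm_le x))

omit [IsUltrametricDist S] in
theorem map_sub_self (x : S) : P (x - P x) = 0 := by rw [map_sub, hP.idem, sub_self]

-- Apply $P$ to $y=1-xy$ with $y$ split into its two components. The kernel component contributes
-- nothing, leaving $Py=-P(x\,Py)$, which forces $Py=0$ because $\|x\|<1$.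
omit [IsUltrametricDist S] in
theorem inverse_ker {x y : S} (hx : ‖x‖ < 1) (hPx : P x = 0) (h : (1 + x) * y = 1) :
    P y = 0 := by
  have hy : y = 1 - x * (y - P y) - x * P y := by rw [← h]; noncomm_ring
  have e : P y = -P (x * P y) := by
    conv_lhs => rw [hy]
    rw [map_sub, map_sub, hP.map_one, hP.ker_mul _ _ hPx (hP.map_sub_self y), sub_zero, zero_sub]
  refine eq_zero_of_norm_le_mul hx ?_
  conv_lhs => rw [e, norm_neg]
  exact (hP.norm_le _).trans (norm_mul_le _ _)

/-- The mirror image of `inverse_ker`, with $1-P$ in place of $P$: the kernel component of $y-1$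
satisfies a homogeneous contracting equation. -/
theorem inverse_range {x y : S} (hx : ‖x‖ < 1) (hPx : P x = x) (h : (1 + x) * y = 1) :
    P (y - 1) = y - 1 := by
  set z := y - 1 with hz
  have e : z = -x - x * P z - x * (z - P z) := by
    have : y = 1 - x * y := by rw [← h]; noncomm_ring
    calc z = (1 - x * y) - 1 := by rw [← this]
      _ = _ := by rw [hz]; noncomm_ring
  have e2 : z - P z = -(x * (z - P z) - P (x * (z - P z))) := by
    have h1 : P z = -x - x * P z - P (x * (z - P z)) := by
      conv_lhs => rw [e]
      rw [map_sub, map_sub, map_neg, hPx, hP.range_mul _ _ hPx (hP.idem z)]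
    calc z - P z = (-x - x * P z - x * (z - P z)) - (-x - x * P z - P (x * (z - P z))) := by
          rw [← h1, ← e]
      _ = _ := by noncomm_ring
  have h0 : z - P z = 0 := by
    refine eq_zero_of_norm_le_mul hx ?_
    conv_lhs => rw [e2, norm_neg]
    exact (hP.norm_sub_le _).trans (norm_mul_le _ _)
  exact (sub_eq_zero.1 h0).symm

-- A solution automatically lies in the range of $P$, and for such $x$ the equation says exactly
-- that $(1+x)(1+E)$ lies in the kernel of $P$.
omit [IsUltrametricDist S] in
theorem exists_fixed [CompleteSpace S] {E : S} (hE : ‖E‖ < 1) :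
    ∃ x, x = -P E - P (x * E) := by
  have hc : ContractingWith ‖E‖₊ fun x : S => -P E - P (x * E) := by
    refine ⟨by exact_mod_cast hE, LipschitzWith.of_dist_le_mul fun x y => ?_⟩
    rw [dist_eq_norm, dist_eq_norm]
    have e : -P E - P (x * E) - (-P E - P (y * E)) = -P ((x - y) * E) := by
      rw [sub_mul, map_sub]; abel
    rw [e, norm_neg, coe_nnnorm, mul_comm]
    exact (hP.norm_le _).trans (norm_mul_le _ _)
  exact ⟨_, hc.fixedPoint_isFixedPt.symm⟩

/-- Every element close to `1` is a product `U V` with `U ∈ 1 + range P` and `V ∈ ker P`; here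
`X = U⁻¹` and `W = V⁻¹`. -/
theorem exists_factorization [CompleteSpace S] {A : S} (hA : ‖A - 1‖ < 1) :
    ∃ U X V W : S, A = U * V ∧ X * A = V ∧ A * W = U ∧ V * W = 1 ∧ W * V = 1 ∧
      P (U - 1) = U - 1 ∧ P (X - 1) = X - 1 ∧ P V = 0 ∧ P W = 0 ∧
      ‖U - 1‖ ≤ ‖A - 1‖ ∧ ‖V - 1‖ ≤ ‖A - 1‖ ∧ ‖W - 1‖ ≤ ‖A - 1‖ := by
  set E := A - 1 with hE
  have hAE : A = 1 + E := by rw [hE]; abel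
  obtain ⟨x, hx⟩ := hP.exists_fixed hA
  have hPx : P x = x := by
    rw [hx, map_sub, map_neg, hP.idem, hP.idem]
  have hxE : ‖x‖ ≤ ‖E‖ := by
    refine norm_le_of_eq_add_mul (y := E) hA le_rfl ?_
    conv_lhs => rw [hx]
    refine (norm_sub_le_max _ _).trans (max_le_max ?_ ?_)
    · rw [norm_neg]; exact hP.norm_le E
    · exact (hP.norm_le _).trans (norm_mul_le _ _)
  have hx1 : ‖x‖ < 1 := hxE.trans_lt hA
  obtain ⟨X, hX⟩ := isUnit_one_add hx1
  have hV1 : ‖(1 + x) * (1 + E) - 1‖ ≤ ‖E‖ := norm_mul_one_add_sub_one_le hA.le hxE le_rfl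
  have hPV : P ((1 + x) * (1 + E)) = 0 := by
    have e : (1 + x) * (1 + E) = 1 + E + x + x * E := by noncomm_ring
    rw [e, map_add, map_add, map_add, hP.map_one, hPx]
    conv_lhs => enter [1, 2]; rw [hx]
    abel
  set v := (1 + x) * (1 + E) - 1 with hv
  have hvV : 1 + v = (1 + x) * (1 + E) := by rw [hv]; abel
  have hv1 : ‖v‖ < 1 := hV1.trans_lt hA
  have hPv : P v = 0 := by rw [hv, map_sub, hPV, hP.map_one, sub_zero]
  obtain ⟨V, hV⟩ := isUnit_one_add hv1
  have hXU : (1 + x) * (↑X⁻¹ : S) = 1 := by rw [← hX, Units.mul_inv]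
  have hUX : (↑X⁻¹ : S) * (1 + x) = 1 := by rw [← hX, Units.inv_mul]
  have hVW : (1 + v) * (↑V⁻¹ : S) = 1 := by rw [← hV, Units.mul_inv]
  have hWV : (↑V⁻¹ : S) * (1 + v) = 1 := by rw [← hV, Units.inv_mul]
  have hAUV : A = ↑X⁻¹ * (1 + v) := by rw [hvV, ← mul_assoc, hUX, one_mul, hAE]
  refine ⟨↑X⁻¹, 1 + x, 1 + v, ↑V⁻¹, hAUV, ?_, ?_, hVW, hWV, hP.inverse_range hx1 hPx hXU, ?_, ?_,
    hP.inverse_ker hv1 hPv hVW, ?_, ?_, ?_⟩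
  · rw [hvV, hAE]
  · rw [hAUV, mul_assoc, hVW, mul_one]
  · rw [add_sub_cancel_left, hPx]
  · rw [map_add, hP.map_one, hPv, add_zero]
  · exact (norm_inverse_sub_one_le hx1 hXU).trans hxE
  · rw [add_sub_cancel_left]; exact hV1
  · exact (norm_inverse_sub_one_le hv1 hVW).trans hV1

omit [IsUltrametricDist S] in
theorem mul_sub_one_range {x y : S} (hx : P (x - 1) = x - 1) (hy : P (y - 1) = y - 1) :
    P (x * y - 1) = x * y - 1 := by
  have e : x * y - 1 = (x - 1) * (y - 1) + (x - 1) + (y - 1) := by noncomm_ring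
  rw [e, map_add, map_add, hP.range_mul _ _ hx hy, hx, hy]

/-- The factorization `A = U V` is unique. -/
theorem factorization_unique [CompleteSpace S] {U V U' V' : S} (h : U * V = U' * V')
    (hU : P (U - 1) = U - 1) (hU' : P (U' - 1) = U' - 1) (hV : P V = 0) (hV' : P V' = 0)
    (hU1 : ‖U - 1‖ < 1) (hV1 : ‖V' - 1‖ < 1) :
    U' = U ∧ V' = V := by
  obtain ⟨Y, hY⟩ := isUnit_one_add hU1
  obtain ⟨Z, hZ⟩ := isUnit_one_add hV1
  rw [add_sub_cancel] at hY hZ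
  have hY1 : U * (↑Y⁻¹ : S) = 1 := by rw [← hY, Units.mul_inv]
  have hY2 : (↑Y⁻¹ : S) * U = 1 := by rw [← hY, Units.inv_mul]
  have hZ1 : V' * (↑Z⁻¹ : S) = 1 := by rw [← hZ, Units.mul_inv]
  have hZ2 : (↑Z⁻¹ : S) * V' = 1 := by rw [← hZ, Units.inv_mul]
  have hPY := hP.inverse_range hU1 hU (by rwa [add_sub_cancel])
  have hPZ := hP.inverse_ker hV1 (by rw [map_sub, hV', hP.map_one, sub_zero])
    (by rwa [add_sub_cancel])
  -- The left side is in $\ker P$ and the right side in $1+\operatorname{range}P$. As $P1=0$, the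
  -- only common element is $1$.
  have e : V * ↑Z⁻¹ = ↑Y⁻¹ * U' := by
    calc V * ↑Z⁻¹ = (↑Y⁻¹ * U) * V * ↑Z⁻¹ := by rw [hY2, one_mul]
      _ = ↑Y⁻¹ * (U * V) * ↑Z⁻¹ := by simp only [mul_assoc]
      _ = ↑Y⁻¹ * U' * (V' * ↑Z⁻¹) := by rw [h]; simp only [mul_assoc]
      _ = ↑Y⁻¹ * U' := by rw [hZ1, mul_one]
  have h1 : ↑Y⁻¹ * U' - 1 = 0 := by
    rw [← hP.mul_sub_one_range hPY hU', ← e, map_sub, hP.ker_mul _ _ hV hPZ, hP.map_one, sub_zero]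
  have hYU : ↑Y⁻¹ * U' = 1 := sub_eq_zero.1 h1
  constructor
  · calc U' = (U * ↑Y⁻¹) * U' := by rw [hY1, one_mul]
      _ = U := by rw [mul_assoc, hYU, mul_one]
  · calc V' = (V * ↑Z⁻¹) * V' := by rw [e, hYU, one_mul]
      _ = V := by rw [mul_assoc, hZ2, mul_one]

end IsSplitting

end Ultrametric

/-! ### The splitting by sign of the exponent. -/

section Projection

variable {K : Type*} [NormedField K]

theorem ConvAt.of_norm_le {ρ : ℝ} (hρ : 0 < ρ) {x y : ℤ → K} (hx : ConvAt ρ x)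
    (h : ∀ i, ‖y i‖ ≤ ‖x i‖) : ConvAt ρ y :=
  squeeze_zero (fun i => mul_nonneg (norm_nonneg _) (zpow_pos hρ i).le)
    (fun i => mul_le_mul_of_nonneg_right (h i) (zpow_pos hρ i).le) hx

variable {ρ : ℝ} [hρ : Fact (0 < ρ)]

namespace CircleRing

/-- The part of a series in positive powers of `u`. -/
def posPart : CircleRing K ρ →+ CircleRing K ρ where
  toFun x := mk (fun i => if 0 < i then x.coeff i else 0) <|
    x.convAt.of_norm_le hρ.out fun i => by split_ifs <;> simp
  map_zero' := by ext i; simp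
  map_add' x y := by
    ext i
    by_cases h : 0 < i
    · rw [coeff_add, coeff_mk, coeff_mk, coeff_mk, if_pos h, if_pos h, if_pos h, coeff_add]
    · rw [coeff_add, coeff_mk, coeff_mk, coeff_mk, if_neg h, if_neg h, if_neg h, add_zero]

theorem coeff_posPart (x : CircleRing K ρ) (i : ℤ) :
    (posPart x).coeff i = if 0 < i then x.coeff i else 0 := rfl

theorem norm_posPart_le (x : CircleRing K ρ) : ‖posPart x‖ ≤ ‖x‖ :=
  norm_le_iff.2 fun i => by
    refine le_trans (mul_le_mul_of_nonneg_right ?_ (zpow_pos hρ.out i).le) (norm_coeff_mul_le x i)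
    rw [coeff_posPart]
    split_ifs <;> simp

theorem posPart_eq_self_iff {x : CircleRing K ρ} :
    posPart x = x ↔ ∀ i ≤ 0, x.coeff i = 0 := by
  constructor
  · intro h i hi
    rw [← h, coeff_posPart, if_neg hi.not_gt]
  · intro h
    ext i
    rw [coeff_posPart]
    split_ifs with hi
    · rfl
    · exact (h i (not_lt.1 hi)).symm

theorem posPart_eq_zero_iff {x : CircleRing K ρ} :
    posPart x = 0 ↔ ∀ i, 0 < i → x.coeff i = 0 := by
  constructor
  · intro h i hi
    have := congrArg (coeff · i) h
    simpa [coeff_posPart, hi] using this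
  · intro h
    ext i
    rw [coeff_posPart]
    split_ifs with hi
    · exact h i hi
    · rfl

theorem posPart_one : posPart (1 : CircleRing K ρ) = 0 :=
  posPart_eq_zero_iff.2 fun i hi => by rw [coeff_one]; simp [hi.ne']

variable [IsUltrametricDist K]

theorem posPart_mul_eq_self {x y : CircleRing K ρ} (hx : posPart x = x) (hy : posPart y = y) :
    posPart (x * y) = x * y := by
  rw [posPart_eq_self_iff] at *
  intro n hn
  rw [coeff_mul]
  refine (tsum_congr fun i => ?_).trans tsum_zero
  rcases le_or_gt i 0 with hi | hi
  · rw [hx i hi, zero_mul]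
  · rw [hy (n - i) (by omega), mul_zero]

theorem posPart_mul_eq_zero {x y : CircleRing K ρ} (hx : posPart x = 0) (hy : posPart y = 0) :
    posPart (x * y) = 0 := by
  rw [posPart_eq_zero_iff] at *
  intro n hn
  rw [coeff_mul]
  refine (tsum_congr fun i => ?_).trans tsum_zero
  rcases le_or_gt i 0 with hi | hi
  · rw [hy (n - i) (by omega), mul_zero]
  · rw [hx i hi, zero_mul]

end CircleRing

attribute [local instance] matrixNormedRing

open CircleRing

variable [IsUltrametricDist K] [CompleteSpace K] {n : ℕ}

/-- The entrywise part of a matrix of series in positive powers of `u`. -/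
def matrixPosPart : Matrix (Fin n) (Fin n) (CircleRing K ρ) →+
    Matrix (Fin n) (Fin n) (CircleRing K ρ) :=
  posPart.mapMatrix

theorem matrixPosPart_apply (M : Matrix (Fin n) (Fin n) (CircleRing K ρ)) (a b : Fin n) :
    matrixPosPart M a b = posPart (M a b) := rfl

/-- Positive exponents are stable under addition, and so are nonpositive ones. The constant term
goes to the kernel, whence $P1=0$ and the normalization $U\in I+(\text{positive powers})$. -/
theorem isSplitting_matrixPosPart :
    IsSplitting (matrixPosPart : Matrix (Fin n) (Fin n) (CircleRing K ρ) →+ _) where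
  idem M := by
    refine Matrix.ext fun a b => ?_
    simp only [matrixPosPart_apply]
    exact posPart_eq_self_iff.2 fun i hi => by rw [coeff_posPart, if_neg hi.not_gt]
  norm_le M := (Matrix.norm_le_iff (norm_nonneg M)).2 fun a b =>
    (norm_posPart_le _).trans (Matrix.norm_entry_le_entrywise_sup_norm M)
  map_one := by
    refine Matrix.ext fun a b => ?_
    rw [matrixPosPart_apply, Matrix.one_apply]
    split_ifs
    · exact posPart_one
    · exact map_zero _
  range_mul M N hM hN := by
    refine Matrix.ext fun a b => ?_
    rw [matrixPosPart_apply, Matrix.mul_apply, map_sum]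
    refine Finset.sum_congr rfl fun c _ => posPart_mul_eq_self ?_ ?_
    · rw [← matrixPosPart_apply, hM]
    · rw [← matrixPosPart_apply, hN]
  ker_mul M N hM hN := by
    refine Matrix.ext fun a b => ?_
    rw [matrixPosPart_apply, Matrix.mul_apply, map_sum]
    refine Finset.sum_eq_zero fun c _ => posPart_mul_eq_zero ?_ ?_
    · rw [← matrixPosPart_apply, hM]; rfl
    · rw [← matrixPosPart_apply, hN]; rfl

end Projection

end Robba

namespace RobbaRing

variable {K : Type*} [NormedField K]

theorem coeff_sub (x y : RobbaRing K) (i : ℤ) : (x - y).coeff i = x.coeff i - y.coeff i := by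
  rw [sub_eq_add_neg, coeff_add, coeff_neg, sub_eq_add_neg]

@[ext] theorem ext {x y : RobbaRing K} (h : ∀ i, x.coeff i = y.coeff i) : x = y :=
  Subtype.ext (funext h)

theorem coeff_sum {ι : Type*} (s : Finset ι) (f : ι → RobbaRing K) (i : ℤ) :
    (∑ a ∈ s, f a).coeff i = ∑ a ∈ s, (f a).coeff i :=
  map_sum (⟨⟨fun x => x.coeff i, rfl⟩, fun _ _ => rfl⟩ : RobbaRing K →+ K) f s

end RobbaRing

namespace Robba

open RobbaRing (gammaAn gammaAnU gammaCon gammaConInv)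

variable {K : Type*} [NormedField K]

theorem CircleRing.coeff_sum {ρ : ℝ} [Fact (0 < ρ)] {ι : Type*} (s : Finset ι)
    (f : ι → CircleRing K ρ) (i : ℤ) :
    (∑ a ∈ s, f a).coeff i = ∑ a ∈ s, (f a).coeff i :=
  map_sum (⟨⟨fun x => x.coeff i, rfl⟩, fun _ _ => rfl⟩ : CircleRing K ρ →+ K) f s

/-! ### Changing the radius for one-sided series. -/

section Convergence

theorem zpow_le_zpow_left_of_nonpos {ρ t : ℝ} (hρ : 0 < ρ) (ht : ρ ≤ t) {i : ℤ} (hi : i ≤ 0) :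
    t ^ i ≤ ρ ^ i := by
  have h := zpow_le_zpow_left₀ (n := -i) (by omega) hρ.le ht
  rw [zpow_neg, zpow_neg] at h
  exact (inv_le_inv₀ (zpow_pos hρ i) (zpow_pos (hρ.trans_le ht) i)).1 h

theorem ConvAt.of_nonpos {ρ t : ℝ} (hρ : 0 < ρ) (ht : ρ ≤ t) {x : ℤ → K} (hx : ConvAt ρ x)
    (h : ∀ i, 0 < i → x i = 0) : ConvAt t x := by
  refine squeeze_zero (fun i => mul_nonneg (norm_nonneg _) (zpow_pos (hρ.trans_le ht) i).le)
    (fun i => ?_) hx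
  rcases lt_or_ge 0 i with hi | hi
  · simp [h i hi]
  · exact mul_le_mul_of_nonneg_left (zpow_le_zpow_left_of_nonpos hρ ht hi) (norm_nonneg _)

theorem ConvAt.of_nonneg {σ t : ℝ} (ht0 : 0 < t) (ht : t ≤ σ) {x : ℤ → K} (hx : ConvAt σ x)
    (h : ∀ i, i < 0 → x i = 0) : ConvAt t x := by
  refine squeeze_zero (fun i => mul_nonneg (norm_nonneg _) (zpow_pos ht0 i).le)
    (fun i => ?_) hx
  rcases lt_or_ge i 0 with hi | hi
  · simp [h i hi]
  · exact mul_le_mul_of_nonneg_left (zpow_le_zpow_left₀ hi ht0.le ht) (norm_nonneg _)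

theorem tendsto_natAbs_cofinite : Tendsto Int.natAbs cofinite atTop := by
  refine tendsto_atTop.2 fun N => ?_
  rw [eventually_cofinite]
  refine (Set.finite_Icc (-(N : ℤ)) N).subset fun i hi => ?_
  simp only [Set.mem_ofPred_eq] at hi
  constructor <;> omega

/-- Enlarging the radius multiplies the term of index $-m$ by $(\rho/t)^m$, which turns boundedness
into decay. -/
theorem ConvAt.of_bounded {ρ t C : ℝ} (hρ : 0 < ρ) (ht : ρ < t) {x : ℤ → K}
    (hC : ∀ i, ‖x i‖ * ρ ^ i ≤ C) (h : ∀ i, 0 < i → x i = 0) : ConvAt t x := by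
  have ht0 := hρ.trans ht
  have hlim : Tendsto (fun i : ℤ => C * (ρ / t) ^ i.natAbs) cofinite (𝓝 0) := by
    have h1 := (tendsto_pow_atTop_nhds_zero_of_lt_one (div_pos hρ ht0).le
      ((div_lt_one ht0).2 ht)).comp tendsto_natAbs_cofinite
    simpa using h1.const_mul C
  have hC0 : 0 ≤ C := le_trans (mul_nonneg (norm_nonneg _) (zpow_pos hρ 0).le) (hC 0)
  refine squeeze_zero (fun i => mul_nonneg (norm_nonneg _) (zpow_pos ht0 i).le)
    (fun i => ?_) hlim
  rcases lt_or_ge 0 i with hi | hi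
  · rw [h i hi, norm_zero, zero_mul]
    have := div_pos hρ ht0
    positivity
  · have e : t ^ i = ρ ^ i * (ρ / t) ^ i.natAbs := by
      rw [← zpow_natCast, Int.ofNat_natAbs_of_nonpos hi, div_zpow, zpow_neg, zpow_neg]
      have := (zpow_pos hρ i).ne'
      have := (zpow_pos ht0 i).ne'
      field_simp
    rw [e, ← mul_assoc]
    exact mul_le_mul_of_nonneg_right (hC i) (pow_nonneg (div_pos hρ ht0).le _)

/-- All but finitely many terms are already below $d$ at radius $\sigma$, hence at every smaller
radius. The remaining finitely many terms are continuous in $t$. -/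
theorem ConvAt.eventually_le {ρ σ c d : ℝ} (hρ : 0 < ρ) (hσ : ρ < σ) {x : ℤ → K}
    (hx : ConvAt σ x) (h : ∀ i, i < 0 → x i = 0) (hc : ∀ i, ‖x i‖ * ρ ^ i ≤ c) (hd : 0 < d)
    (hcd : c < d) : ∀ᶠ t in 𝓝[>] ρ, ∀ i, ‖x i‖ * t ^ i ≤ d := by
  have hfin : {i : ℤ | ¬ ‖x i‖ * σ ^ i < d}.Finite := by
    have := hx.eventually (gt_mem_nhds hd)
    rwa [eventually_cofinite] at this
  have hev : ∀ i ∈ {i : ℤ | ¬ ‖x i‖ * σ ^ i < d}, ∀ᶠ t in 𝓝[>] ρ, ‖x i‖ * t ^ i ≤ d := by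
    intro i _
    have hcont : Tendsto (fun t : ℝ => ‖x i‖ * t ^ i) (𝓝[>] ρ) (𝓝 (‖x i‖ * ρ ^ i)) :=
      ((continuousAt_zpow₀ ρ i (Or.inl hρ.ne')).tendsto.const_mul _).mono_left
        nhdsWithin_le_nhds
    exact (hcont.eventually (gt_mem_nhds ((hc i).trans_lt hcd))).mono fun t ht => ht.le
  filter_upwards [(eventually_all_finite hfin).2 hev, Ioo_mem_nhdsGT hσ] with t ht htσ i
  by_cases hi : ‖x i‖ * σ ^ i < d
  · rcases lt_or_ge i 0 with hi0 | hi0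
    · simp [h i hi0, hd.le]
    · exact (mul_le_mul_of_nonneg_left
        (zpow_le_zpow_left₀ hi0 (hρ.trans htσ.1).le htσ.2.le) (norm_nonneg _)).trans hi.le
  · exact ht i hi

end Convergence

/-! ### Translating $w_r$ into norm bounds. -/

section Valuation

variable (p : ℕ) [Fact p.Prime]

theorem one_lt_prime : (1 : ℝ) < p := by exact_mod_cast (Fact.out : p.Prime).one_lt

theorem coe_le_add_padicVal_iff {r c : ℝ} (y : K) (i : ℤ) :
    (c : EReal) ≤ ((r * i : ℝ) : EReal) + padicVal p y ↔
      ‖y‖ * ((p : ℝ) ^ (-r)) ^ i ≤ (p : ℝ) ^ (-c) := by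
  have hp := one_lt_prime p
  have hp0 : (0 : ℝ) < p := zero_lt_one.trans hp
  rw [padicVal]
  split_ifs with hy
  · rw [EReal.coe_add_top]
    simp [hy, Real.rpow_nonneg hp0.le]
  · rw [← EReal.coe_add, EReal.coe_le_coe_iff, ← Real.rpow_intCast, ← Real.rpow_mul hp0.le]
    have e : ‖y‖ = (p : ℝ) ^ Real.logb p ‖y‖ :=
      (Real.rpow_logb hp0 hp.ne' (norm_pos_iff.2 hy)).symm
    conv_rhs => rw [e]
    rw [← Real.rpow_add hp0, Real.rpow_le_rpow_left_iff hp]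
    constructor <;> intro h <;> linarith

theorem coe_le_naiveValMatrix_iff {r c : ℝ} {n : ℕ} (M : Matrix (Fin n) (Fin n) (RobbaRing K)) :
    (c : EReal) ≤ naiveValMatrix p r M ↔
      ∀ a b i, ‖(M a b).coeff i‖ * ((p : ℝ) ^ (-r)) ^ i ≤ (p : ℝ) ^ (-c) := by
  simp only [naiveValMatrix, naiveVal, le_iInf_iff, coe_le_add_padicVal_iff]

theorem exists_bound_of_naiveValMatrix_pos {r : ℝ} {n : ℕ}
    {M : Matrix (Fin n) (Fin n) (RobbaRing K)} (h : 0 < naiveValMatrix p r M) :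
    ∃ c : ℝ, 0 < c ∧ c < 1 ∧ ∀ a b i, ‖(M a b).coeff i‖ * ((p : ℝ) ^ (-r)) ^ i ≤ c := by
  obtain ⟨c, hc0, hc⟩ := EReal.lt_iff_exists_real_btwn.1 h
  have hp := one_lt_prime p
  exact ⟨_, Real.rpow_pos_of_pos (zero_lt_one.trans hp) (-c),
    Real.rpow_lt_one_of_one_lt_of_neg hp (neg_lt_zero.2 (EReal.coe_pos.1 hc0)),
    (coe_le_naiveValMatrix_iff p M).1 hc.le⟩

end Valuation

/-! ### Passing between the Robba ring and a circle ring, neither of which contains the other. -/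

section SameCoeff

variable {ρ : ℝ} [hρ : Fact (0 < ρ)] {n : ℕ}

/-- A matrix over the Robba ring and a matrix over the circle ring have the same coefficients. -/
def SameCoeff (M : Matrix (Fin n) (Fin n) (RobbaRing K))
    (N : Matrix (Fin n) (Fin n) (CircleRing K ρ)) : Prop :=
  ∀ a b i, (M a b).coeff i = (N a b).coeff i

namespace SameCoeff

variable {M M' : Matrix (Fin n) (Fin n) (RobbaRing K)}
  {N N' : Matrix (Fin n) (Fin n) (CircleRing K ρ)}

theorem convAt (h : SameCoeff M N) (a b : Fin n) : ConvAt ρ (M a b).coeff := by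
  rw [funext (h a b)]
  exact (N a b).convAt

theorem left_unique (h : SameCoeff M N) (h' : SameCoeff M' N) : M = M' :=
  Matrix.ext fun a b => RobbaRing.ext fun i => (h a b i).trans (h' a b i).symm

theorem right_unique (h : SameCoeff M N) (h' : SameCoeff M N') : N = N' :=
  Matrix.ext fun a b => CircleRing.ext fun i => (h a b i).symm.trans (h' a b i)

theorem add (h : SameCoeff M N) (h' : SameCoeff M' N') : SameCoeff (M + M') (N + N') :=
  fun a b i => congrArg₂ (· + ·) (h a b i) (h' a b i)

variable [IsUltrametricDist K] [CompleteSpace K]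

theorem one : SameCoeff (1 : Matrix (Fin n) (Fin n) (RobbaRing K))
    (1 : Matrix (Fin n) (Fin n) (CircleRing K ρ)) := fun a b i => by
  rw [Matrix.one_apply, Matrix.one_apply]
  split_ifs <;> rfl

theorem sub (h : SameCoeff M N) (h' : SameCoeff M' N') : SameCoeff (M - M') (N - N') :=
  fun a b i => by
    rw [Matrix.sub_apply, Matrix.sub_apply, RobbaRing.coeff_sub, CircleRing.coeff_sub, h, h']

theorem mul (h : SameCoeff M N) (h' : SameCoeff M' N') : SameCoeff (M * M') (N * N') :=
  fun a b i => by
    rw [Matrix.mul_apply, Matrix.mul_apply, RobbaRing.coeff_sum, CircleRing.coeff_sum]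
    refine Finset.sum_congr rfl fun c _ => ?_
    rw [RobbaRing.coeff_mul, CircleRing.coeff_mul]
    exact tsum_congr fun j => by rw [h, h']

theorem left_eq_one (h : SameCoeff M (1 : Matrix (Fin n) (Fin n) (CircleRing K ρ))) : M = 1 :=
  h.left_unique one

end SameCoeff

/-- The matrix over the circle ring with the coefficients of a given matrix. -/
def toCircle (M : Matrix (Fin n) (Fin n) (RobbaRing K))
    (hM : ∀ a b, ConvAt ρ (M a b).coeff) : Matrix (Fin n) (Fin n) (CircleRing K ρ) :=
  fun a b => CircleRing.mk (M a b).coeff (hM a b)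

theorem sameCoeff_toCircle (M : Matrix (Fin n) (Fin n) (RobbaRing K))
    (hM : ∀ a b, ConvAt ρ (M a b).coeff) : SameCoeff M (toCircle M hM) := fun _ _ _ => rfl

/-- Without positive powers, convergence on one circle propagates to every larger radius. -/
theorem exists_sameCoeff_of_nonpos (hρ1 : ρ < 1)
    {N : Matrix (Fin n) (Fin n) (CircleRing K ρ)} (hN : ∀ a b i, 0 < i → (N a b).coeff i = 0) :
    ∃ M : Matrix (Fin n) (Fin n) (RobbaRing K), SameCoeff M N :=
  ⟨fun a b => ⟨(N a b).coeff, ρ, hρ.out, hρ1, fun _ ht _ =>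
    (N a b).convAt.of_nonpos hρ.out ht (hN a b)⟩, fun _ _ _ => rfl⟩

end SameCoeff

/-! ### The normalized factorization: existence, uniqueness, estimates. -/

section Factorization

attribute [local instance] matrixNormedRing

variable [IsUltrametricDist K] [CompleteSpace K] {n : ℕ}

theorem matrixPosPart_eq_self_iff {ρ : ℝ} [Fact (0 < ρ)]
    {N : Matrix (Fin n) (Fin n) (CircleRing K ρ)} :
    matrixPosPart N = N ↔ ∀ a b, ∀ i ≤ 0, (N a b).coeff i = 0 := by
  simp only [← CircleRing.posPart_eq_self_iff, ← matrixPosPart_apply]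
  exact Matrix.ext_iff.symm

theorem matrixPosPart_eq_zero_iff {ρ : ℝ} [Fact (0 < ρ)]
    {N : Matrix (Fin n) (Fin n) (CircleRing K ρ)} :
    matrixPosPart N = 0 ↔ ∀ a b i, 0 < i → (N a b).coeff i = 0 := by
  simp only [← CircleRing.posPart_eq_zero_iff, ← matrixPosPart_apply]
  exact Matrix.ext_iff.symm

theorem matrix_norm_le_iff {ρ : ℝ} [Fact (0 < ρ)]
    {N : Matrix (Fin n) (Fin n) (CircleRing K ρ)} {c : ℝ} (hc : 0 ≤ c) :
    ‖N‖ ≤ c ↔ ∀ a b i, ‖(N a b).coeff i‖ * ρ ^ i ≤ c :=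
  (Matrix.norm_le_iff hc).trans
    (forall_congr' fun _ => forall_congr' fun _ => CircleRing.norm_le_iff)

theorem norm_matrix_one_le {ρ : ℝ} [Fact (0 < ρ)] :
    ‖(1 : Matrix (Fin n) (Fin n) (CircleRing K ρ))‖ ≤ 1 :=
  (Matrix.norm_le_iff zero_le_one).2 fun a b => by
    rw [Matrix.one_apply]
    split_ifs <;> simp

/-- Since $\rho^i\ge 1$ for $i\le 0$, the norm on the circle dominates the coefficients themselves.
This puts $V$ and $V^{-1}$ over $\Gamma_{\mathrm{con}}$. -/
theorem norm_coeff_le_one_of_nonpos {ρ : ℝ} [hρ : Fact (0 < ρ)] (hρ1 : ρ < 1)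
    {N : Matrix (Fin n) (Fin n) (CircleRing K ρ)} (hN : matrixPosPart N = 0) (h1 : ‖N - 1‖ < 1)
    (a b : Fin n) (i : ℤ) : ‖(N a b).coeff i‖ ≤ 1 := by
  have hN1 : ‖N‖ ≤ 1 := by
    have h := IsUltrametricDist.norm_add_le_max (N - 1) 1
    rw [sub_add_cancel] at h
    exact h.trans (max_le h1.le norm_matrix_one_le)
  rcases lt_or_ge 0 i with hi | hi
  · rw [matrixPosPart_eq_zero_iff.1 hN a b i hi]
    simp
  · have h := (matrix_norm_le_iff zero_le_one).1 hN1 a b i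
    have h2 : 1 ≤ ρ ^ i := one_le_zpow_of_nonpos₀ hρ.out hρ1.le hi
    nlinarith [norm_nonneg ((N a b).coeff i)]

theorem coeff_eq_zero_of_sub_one {M : Matrix (Fin n) (Fin n) (RobbaRing K)}
    (h : ∀ a b, ∀ i ≤ 0, ((M - 1) a b).coeff i = 0) (a b : Fin n) (i : ℤ) (hi : i < 0) :
    (M a b).coeff i = 0 := by
  have h1 := h a b i hi.le
  rw [Matrix.sub_apply, RobbaRing.coeff_sub, sub_eq_zero] at h1
  rw [h1, Matrix.one_apply]
  split_ifs
  · rw [RobbaRing.coeff_one]; simp [hi.ne]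
  · rfl

theorem invertibleOver_iff {S : Subring (RobbaRing K)}
    {M : Matrix (Fin n) (Fin n) (RobbaRing K)} :
    InvertibleOver S M ↔ (∀ a b, M a b ∈ S) ∧ ∃ M' : Matrix (Fin n) (Fin n) (RobbaRing K),
      (∀ a b, M' a b ∈ S) ∧ M * M' = 1 ∧ M' * M = 1 := by
  constructor
  · rintro ⟨g, rfl⟩
    refine ⟨fun a b => (g.1 a b).2, (Matrix.GeneralLinearGroup.map S.subtype g⁻¹ :
      Matrix (Fin n) (Fin n) (RobbaRing K)), fun a b => ((g⁻¹).1 a b).2, ?_, ?_⟩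
    · rw [← Units.val_mul, ← map_mul, mul_inv_cancel, map_one, Units.val_one]
    · rw [← Units.val_mul, ← map_mul, inv_mul_cancel, map_one, Units.val_one]
  · rintro ⟨hM, M', hM', h1, h2⟩
    have hinj : Function.Injective (S.subtype.mapMatrix (m := Fin n)) :=
      Matrix.map_injective S.subtype_injective
    refine ⟨⟨Matrix.of fun a b => ⟨M a b, hM a b⟩, Matrix.of fun a b => ⟨M' a b, hM' a b⟩,
      hinj ?_, hinj ?_⟩, ?_⟩
    · rw [map_mul, map_one]; exact h1
    · rw [map_mul, map_one]; exact h2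
    · rfl

theorem mem_gammaConInv_of_norm_le_one {p : ℕ} {x : RobbaRing K} (hx : ∀ i, ‖x.coeff i‖ ≤ 1) :
    x ∈ gammaConInv K p :=
  ⟨0, by rw [pow_zero, one_mul]; exact hx⟩

/-- The gluing step. The factor $U$ is found only on the circle, but it equals $AV^{-1}$, and both
$A$ and $V^{-1}$ converge on an annulus reaching $|u|=1$. In the same way $U^{-1}=VA^{-1}$ extends
as soon as $A^{-1}$ converges on the circle. -/
theorem exists_robba_factorization {ρ : ℝ} [hρ : Fact (0 < ρ)] (hρ1 : ρ < 1)
    {A : Matrix (Fin n) (Fin n) (RobbaRing K)} {A₀ : Matrix (Fin n) (Fin n) (CircleRing K ρ)}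
    (hA : SameCoeff A A₀) (hA1 : ‖A₀ - 1‖ < 1) :
    ∃ U V W : Matrix (Fin n) (Fin n) (RobbaRing K), A = U * V ∧ V * W = 1 ∧ W * V = 1 ∧
      (∀ a b, ∀ i ≤ 0, ((U - 1) a b).coeff i = 0) ∧ (∀ a b i, 0 < i → (V a b).coeff i = 0) ∧
      (∀ a b i, ‖((U - 1) a b).coeff i‖ * ρ ^ i ≤ ‖A₀ - 1‖) ∧
      (∀ a b i, ‖((V - 1) a b).coeff i‖ * ρ ^ i ≤ ‖A₀ - 1‖) ∧
      (∀ a b i, ‖(V a b).coeff i‖ ≤ 1) ∧ (∀ a b i, ‖(W a b).coeff i‖ ≤ 1) ∧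
      (∀ a b, ConvAt ρ (V a b).coeff) ∧
      ∀ A' : Matrix (Fin n) (Fin n) (RobbaRing K), (∀ a b, ConvAt ρ (A' a b).coeff) →
        A * A' = 1 → A' * A = 1 → ∃ X : Matrix (Fin n) (Fin n) (RobbaRing K),
          U * X = 1 ∧ X * U = 1 ∧ ∀ a b, ∀ i < 0, (X a b).coeff i = 0 := by
  obtain ⟨U₀, X₀, V₀, W₀, hUV, hXA, hAW, hVW, hWV, hU, hX, hV, hW, hU1, hV1, hW1⟩ :=
    isSplitting_matrixPosPart.exists_factorization hA1
  obtain ⟨V, hVV⟩ := exists_sameCoeff_of_nonpos hρ1 (matrixPosPart_eq_zero_iff.1 hV)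
  obtain ⟨W, hWW⟩ := exists_sameCoeff_of_nonpos hρ1 (matrixPosPart_eq_zero_iff.1 hW)
  -- The Robba matrix $AW$ serves as $U$; its vanishing coefficients are read off from $U_0$.
  have hUU : SameCoeff (A * W) U₀ := hAW ▸ hA.mul hWW
  have hVW' : V * W = 1 := (hVW ▸ hVV.mul hWW).left_eq_one
  have hWV' : W * V = 1 := (hWV ▸ hWW.mul hVV).left_eq_one
  refine ⟨A * W, V, W, ?_, hVW', hWV', ?_, ?_, ?_, ?_, ?_, ?_, hVV.convAt, ?_⟩
  · rw [mul_assoc, hWV', mul_one]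
  · intro a b i hi
    rw [hUU.sub SameCoeff.one]
    exact matrixPosPart_eq_self_iff.1 hU a b i hi
  · intro a b i hi
    rw [hVV]
    exact matrixPosPart_eq_zero_iff.1 hV a b i hi
  · intro a b i
    rw [hUU.sub SameCoeff.one]
    exact (matrix_norm_le_iff (norm_nonneg _)).1 hU1 a b i
  · intro a b i
    rw [hVV.sub SameCoeff.one]
    exact (matrix_norm_le_iff (norm_nonneg _)).1 hV1 a b i
  · intro a b i
    rw [hVV]
    exact norm_coeff_le_one_of_nonpos hρ1 hV (hV1.trans_lt hA1) a b i
  · intro a b i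
    rw [hWW]
    exact norm_coeff_le_one_of_nonpos hρ1 hW (hW1.trans_lt hA1) a b i
  · intro A' hA' h1 h2
    have hA₀' := sameCoeff_toCircle A' hA'
    have h3 : A₀ * toCircle A' hA' = 1 := (hA.mul hA₀').right_unique (h1 ▸ SameCoeff.one)
    have hXX : SameCoeff (V * A') X₀ := by
      have : V₀ * toCircle A' hA' = X₀ := by rw [← hXA, mul_assoc, h3, mul_one]
      exact this ▸ hVV.mul hA₀'
    refine ⟨V * A', ?_, ?_, coeff_eq_zero_of_sub_one fun a b i hi => ?_⟩
    · rw [mul_assoc, ← mul_assoc W, hWV', one_mul, h1]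
    · rw [mul_assoc, ← mul_assoc A', h2, one_mul, hVW']
    · rw [hXX.sub SameCoeff.one]
      exact matrixPosPart_eq_self_iff.1 hX a b i hi

/-- The condition $w_r(V-I)>0$ bounds $V$ on $|u|=p^{-r}$ without giving convergence there, so a
strictly larger radius $t$ is needed. There $V-I$ only gets smaller, while $U-I$ may grow, but
continuously, so its norm stays below $1$ for $t$ close to $p^{-r}$. -/
theorem IsNormalizedFactorization.exists_circle {p : ℕ} [Fact p.Prime] {r : ℝ} (hr : 0 < r)
    {A U V : Matrix (Fin n) (Fin n) (RobbaRing K)} (h : IsNormalizedFactorization p r A U V) :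
    ∀ᶠ t in 𝓝[>] ((p : ℝ) ^ (-r)), ∀ _ : Fact (0 < t),
      ∃ U₀ V₀ : Matrix (Fin n) (Fin n) (CircleRing K t), SameCoeff U U₀ ∧ SameCoeff V V₀ ∧
        matrixPosPart (U₀ - 1) = U₀ - 1 ∧ matrixPosPart V₀ = 0 ∧
        ‖U₀ - 1‖ < 1 ∧ ‖V₀ - 1‖ < 1 := by
  have hρ := RobbaRing.rpow_pos' p r
  have hρ1 : (p : ℝ) ^ (-r) < 1 :=
    Real.rpow_lt_one_of_one_lt_of_neg (one_lt_prime p) (neg_lt_zero.2 hr)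
  set ρ := (p : ℝ) ^ (-r)
  obtain ⟨c, hc0, hc1, hc⟩ := exists_bound_of_naiveValMatrix_pos p h.left_pos
  obtain ⟨d, hd0, hd1, hd⟩ := exists_bound_of_naiveValMatrix_pos p h.right_pos
  obtain ⟨e, hce, he1⟩ := exists_between hc1
  have hneg : ∀ a b, ∀ i < 0, ((U - 1) a b).coeff i = 0 :=
    fun a b i hi => h.left_powers a b i hi.le
  have hconv : ∀ a b, ∃ σ, ρ < σ ∧ ConvAt σ ((U - 1) a b).coeff := fun a b => by
    obtain ⟨η, _, hη1, hη⟩ := ((U - 1) a b).2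
    obtain ⟨σ, hσ, hσ1⟩ := exists_between (max_lt hη1 hρ1)
    exact ⟨σ, (le_max_right _ _).trans_lt hσ, hη σ ((le_max_left _ _).trans hσ.le) hσ1⟩
  choose σ hσ hσU using hconv
  have hall : ∀ᶠ t in 𝓝[>] ρ, ∀ a b i, ‖((U - 1) a b).coeff i‖ * t ^ i ≤ e :=
    eventually_all.2 fun a => eventually_all.2 fun b =>
      (hσU a b).eventually_le hρ (hσ a b) (hneg a b) (hc a b) (hc0.trans hce) hce
  have hlt : ∀ᶠ t in 𝓝[>] ρ, ∀ a b, t < σ a b :=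
    eventually_all.2 fun a => eventually_all.2 fun b =>
      mem_of_superset (Ioo_mem_nhdsGT (hσ a b)) fun t ht => ht.2
  filter_upwards [hall, hlt, self_mem_nhdsWithin] with t ht htσ htρ ht0
  rw [Set.mem_Ioi] at htρ
  have hUc : ∀ a b, ConvAt t ((U - 1) a b).coeff := fun a b =>
    (hσU a b).of_nonneg ht0.out (htσ a b).le (hneg a b)
  have hVpos : ∀ a b i, 0 < i → ((V - 1) a b).coeff i = 0 := fun a b i hi => by
    rw [Matrix.sub_apply, RobbaRing.coeff_sub, h.right_powers a b i hi, Matrix.one_apply]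
    split_ifs
    · rw [RobbaRing.coeff_one]; simp [hi.ne']
    · simp [RobbaRing.coeff_zero]
  have hVc : ∀ a b, ConvAt t ((V - 1) a b).coeff := fun a b =>
    ConvAt.of_bounded hρ htρ (hd a b) (hVpos a b)
  have hU₀ := sameCoeff_toCircle (ρ := t) (U - 1) hUc
  have hV₀ := sameCoeff_toCircle (ρ := t) (V - 1) hVc
  refine ⟨toCircle (U - 1) hUc + 1, toCircle (V - 1) hVc + 1, ?_, ?_, ?_, ?_, ?_, ?_⟩
  · simpa using hU₀.add SameCoeff.one
  · simpa using hV₀.add SameCoeff.one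
  · rw [add_sub_cancel_right]
    exact matrixPosPart_eq_self_iff.2 h.left_powers
  · rw [map_add, isSplitting_matrixPosPart.map_one, add_zero]
    exact matrixPosPart_eq_zero_iff.2 hVpos
  · rw [add_sub_cancel_right]
    exact ((matrix_norm_le_iff (hc0.trans hce).le).2 ht).trans_lt he1
  · rw [add_sub_cancel_right]
    refine ((matrix_norm_le_iff hd0.le).2 fun a b i => ?_).trans_lt hd1
    rcases lt_or_ge 0 i with hi | hi
    · have : (toCircle (V - 1) hVc a b).coeff i = 0 := hVpos a b i hi
      rw [this]
      simpa using hd0.le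
    · exact (mul_le_mul_of_nonneg_left (zpow_le_zpow_left_of_nonpos hρ htρ.le hi)
        (norm_nonneg _)).trans (hd a b i)

theorem IsNormalizedFactorization.unique {p : ℕ} [Fact p.Prime] {r : ℝ} (hr : 0 < r)
    {A U V U' V' : Matrix (Fin n) (Fin n) (RobbaRing K)}
    (h : IsNormalizedFactorization p r A U V) (h' : IsNormalizedFactorization p r A U' V') :
    U' = U ∧ V' = V := by
  obtain ⟨t, ht, ht', htρ⟩ := ((IsNormalizedFactorization.exists_circle hr h).and
    ((IsNormalizedFactorization.exists_circle hr h').and self_mem_nhdsWithin)).exists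
  have : Fact (0 < t) := ⟨(RobbaRing.rpow_pos' p r).trans htρ⟩
  obtain ⟨U₀, V₀, hU, hV, hPU, hPV, hU1, _⟩ := ht inferInstance
  obtain ⟨U₀', V₀', hU', hV', hPU', hPV', _, hV1'⟩ := ht' inferInstance
  have e : U₀ * V₀ = U₀' * V₀' :=
    (h.eq_mul ▸ hU.mul hV : SameCoeff A (U₀ * V₀)).right_unique
      (h'.eq_mul ▸ hU'.mul hV' : SameCoeff A (U₀' * V₀'))
  obtain ⟨rfl, rfl⟩ := isSplitting_matrixPosPart.factorization_unique e hPU hPU' hPV hPV' hU1 hV1'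
  exact ⟨hU'.left_unique hU, hV'.left_unique hV⟩

theorem exists_normalized_factorization {p : ℕ} [Fact p.Prime] {r : ℝ} (hr : 0 < r)
    {A : Matrix (Fin n) (Fin n) (RobbaRing K)} (hA : ∀ a b, A a b ∈ gammaAn K p r)
    (hA1 : 0 < naiveValMatrix p r (A - 1)) :
    ∃ U V : Matrix (Fin n) (Fin n) (RobbaRing K),
      IsNormalizedFactorization p r A U V ∧
      (∀ U' V' : Matrix (Fin n) (Fin n) (RobbaRing K),
        IsNormalizedFactorization p r A U' V' → U' = U ∧ V' = V) ∧
      (∀ a b, V a b ∈ gammaAn K p r) ∧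
      InvertibleOver (gammaConInv K p) V ∧
      (InvertibleOver (gammaAn K p r) A → InvertibleOver (gammaAnU K) U) ∧
      naiveValMatrix p r (A - 1) ≤
        min (naiveValMatrix p r (U - 1)) (naiveValMatrix p r (V - 1)) := by
  have : Fact (0 < (p : ℝ) ^ (-r)) := ⟨RobbaRing.rpow_pos' p r⟩
  have hρ1 : (p : ℝ) ^ (-r) < 1 :=
    Real.rpow_lt_one_of_one_lt_of_neg (one_lt_prime p) (neg_lt_zero.2 hr)
  have hA₀ := sameCoeff_toCircle (ρ := (p : ℝ) ^ (-r)) A hA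
  obtain ⟨c, hc0, hc1, hc⟩ := exists_bound_of_naiveValMatrix_pos p hA1
  have hlt : ‖toCircle (ρ := (p : ℝ) ^ (-r)) A hA - 1‖ < 1 := by
    refine ((matrix_norm_le_iff hc0.le).2 fun a b i => ?_).trans_lt hc1
    rw [← hA₀.sub SameCoeff.one]
    exact hc a b i
  obtain ⟨U, V, W, hUV, hVW, hWV, hUp, hVp, hU1, hV1, hVb, hWb, hVc, hinv⟩ :=
    exists_robba_factorization hρ1 hA₀ hlt
  have hle : naiveValMatrix p r (A - 1) ≤
      min (naiveValMatrix p r (U - 1)) (naiveValMatrix p r (V - 1)) := by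
    -- The value $w_r(A-I)$ may be infinite, so the inequality is tested on real numbers below it.
    refine EReal.ge_of_forall_gt_iff_ge.1 fun z hz => ?_
    have hz' : ‖toCircle (ρ := (p : ℝ) ^ (-r)) A hA - 1‖ ≤ (p : ℝ) ^ (-z) := by
      refine (matrix_norm_le_iff (RobbaRing.rpow_pos' p z).le).2 fun a b i => ?_
      rw [← hA₀.sub SameCoeff.one]
      exact (coe_le_naiveValMatrix_iff p _).1 hz.le a b i
    exact le_min ((coe_le_naiveValMatrix_iff p _).2 fun a b i => (hU1 a b i).trans hz')
      ((coe_le_naiveValMatrix_iff p _).2 fun a b i => (hV1 a b i).trans hz')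
  have hVm : ∀ a b, V a b ∈ gammaConInv K p := fun a b =>
    mem_gammaConInv_of_norm_le_one (hVb a b)
  have hUm : ∀ a b, U a b ∈ gammaAnU K := fun a b => coeff_eq_zero_of_sub_one hUp a b
  have hnorm : IsNormalizedFactorization p r A U V :=
    { eq_mul := hUV
      left_mem := hUm
      right_mem := hVm
      left_powers := hUp
      right_powers := hVp
      left_pos := hA1.trans_le (hle.trans (min_le_left _ _))
      right_pos := hA1.trans_le (hle.trans (min_le_right _ _)) }
  refine ⟨U, V, hnorm, fun U' V' h' => IsNormalizedFactorization.unique hr hnorm h', hVc,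
    invertibleOver_iff.2 ⟨hVm, W, fun a b => mem_gammaConInv_of_norm_le_one (hWb a b), hVW, hWV⟩,
    fun hAi => ?_, hle⟩
  obtain ⟨-, A', hA', h1, h2⟩ := invertibleOver_iff.1 hAi
  obtain ⟨X, hX1, hX2, hX⟩ := hinv A' hA' h1 h2
  exact invertibleOver_iff.2 ⟨hUm, X, hX, hX1, hX2⟩

end Factorization

end Robba

namespace Robba

/-! ### Generation of $SL_n$ over a field by transvections. -/

section Whitehead

variable {R : Type*} [Field R] {n : Type*} [Fintype n] [DecidableEq n]

/-- The monoid generated by the transvections. -/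
def transvectionMonoid (n R : Type*) [Fintype n] [DecidableEq n] [CommRing R] :
    Submonoid (Matrix n n R) :=
  Submonoid.closure {T | ∃ i j c, i ≠ j ∧ T = Matrix.transvection i j c}

theorem transvection_mem {i j : n} (h : i ≠ j) (c : R) :
    Matrix.transvection i j c ∈ transvectionMonoid n R :=
  Submonoid.subset_closure ⟨i, j, c, h, rfl⟩

theorem list_transvection_prod_mem (L : List (Matrix.TransvectionStruct n R)) :
    (L.map Matrix.TransvectionStruct.toMatrix).prod ∈ transvectionMonoid n R :=
  Submonoid.list_prod_mem _ fun T hT => by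
    obtain ⟨t, -, rfl⟩ := List.mem_map.1 hT
    exact transvection_mem t.hij t.c

/-- Whitehead's identity for $\mathrm{diag}(a,a^{-1})$, checked entry by entry. -/
theorem diagonal_pair_eq {i j : n} (h : i ≠ j) {a : R} (ha : a ≠ 0) :
    Matrix.diagonal (fun x => if x = i then a else if x = j then a⁻¹ else 1) =
      Matrix.transvection j i (-((a - 1) / a)) * (Matrix.transvection i j 1 *
        (Matrix.transvection j i (a - 1) * Matrix.transvection i j (-a⁻¹))) := by
  simp only [Matrix.transvection, add_mul, mul_add, one_mul, mul_one,
    Matrix.single_mul_single_same, Matrix.single_mul_single_of_ne _ _ _ _ h,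
    Matrix.single_mul_single_of_ne _ _ _ _ h.symm, add_zero]
  ext x y
  simp only [Matrix.diagonal_apply, Matrix.add_apply, Matrix.one_apply, Matrix.single_apply]
  by_cases hxi : x = i
  · subst hxi
    by_cases hyx : y = x
    · subst hyx
      simp [h.symm]
    · by_cases hyj : y = j
      · subst hyj
        simp [h, h.symm]
        field_simp
        ring
      · simp [Ne.symm hyx, Ne.symm hyj, h.symm]
  · by_cases hxj : x = j
    · subst hxj
      by_cases hyx : y = x
      · subst hyx
        simp [h, h.symm]
        field_simp
        ring
      · by_cases hyi : y = i
        · subst hyi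
          simp [h, h.symm]
          field_simp
          ring
        · simp [Ne.symm hyx, Ne.symm hyi, h]
    · simp [hxi, Ne.symm hxi, hxj, Ne.symm hxj]

theorem diagonal_pair_mem {i j : n} (h : i ≠ j) {a : R} (ha : a ≠ 0) :
    Matrix.diagonal (fun x => if x = i then a else if x = j then a⁻¹ else 1) ∈
      transvectionMonoid n R := by
  rw [diagonal_pair_eq h ha]
  exact mul_mem (transvection_mem h.symm _) (mul_mem (transvection_mem h _)
    (mul_mem (transvection_mem h.symm _) (transvection_mem h _)))

/-- The slot $j$ collects the inverses: each induction step multiplies by one pair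
$\mathrm{diag}(D_a,D_a^{-1})$ in positions $a$ and $j$. -/
theorem diagonal_mem_of_finset (D : n → R) (hD : ∀ i, D i ≠ 0) (j : n) (s : Finset n)
    (hj : j ∉ s) :
    Matrix.diagonal (fun x => if x ∈ s then D x else if x = j then (∏ i ∈ s, D i)⁻¹ else 1) ∈
      transvectionMonoid n R := by
  induction s using Finset.induction_on with
  | empty => simp [one_mem]
  | insert a s has ih =>
    rw [Finset.mem_insert, not_or] at hj
    have h := mul_mem (diagonal_pair_mem (Ne.symm hj.1) (hD a)) (ih hj.2)
    rw [Matrix.diagonal_mul_diagonal] at h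
    convert h using 2
    funext x
    rw [Finset.prod_insert has, mul_inv]
    by_cases hxa : x = a
    · subst hxa
      simp [has, Ne.symm hj.1]
    · by_cases hxj : x = j
      · subst hxj
        simp [hj.1, hj.2]
      · simp [hxa, hxj]

theorem diagonal_mem (D : n → R) (hD : ∏ i, D i = 1) :
    Matrix.diagonal D ∈ transvectionMonoid n R := by
  rcases isEmpty_or_nonempty n with hn | ⟨⟨j⟩⟩
  · rw [Subsingleton.elim (Matrix.diagonal D) 1]
    exact one_mem _
  have hD0 : ∀ i, D i ≠ 0 := fun i hi => by
    rw [Finset.prod_eq_zero (Finset.mem_univ i) hi] at hD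
    exact zero_ne_one hD
  convert diagonal_mem_of_finset D hD0 j (Finset.univ.erase j) (Finset.notMem_erase _ _) using 2
  funext x
  by_cases hx : x = j
  · subst hx
    rw [← Finset.mul_prod_erase _ _ (Finset.mem_univ x)] at hD
    simp only [Finset.mem_erase, ne_eq, not_true_eq_false, false_and, if_false, if_true]
    exact eq_inv_of_mul_eq_one_left hD
  · simp [hx]

/-- Over a field, a matrix of determinant `1` is a product of transvections. -/
theorem mem_transvectionMonoid_of_det_eq_one (M : Matrix n n R) (hM : M.det = 1) :
    M ∈ transvectionMonoid n R := by
  obtain ⟨L, L', D, rfl⟩ := Matrix.Pivot.exists_list_transvec_mul_diagonal_mul_list_transvec M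
  refine mul_mem (mul_mem (list_transvection_prod_mem L) (diagonal_mem D ?_))
    (list_transvection_prod_mem L')
  simpa using hM

end Whitehead

theorem mem_transvectionMonoid_of_isField {R : Type*} [CommRing R] (hR : IsField R)
    {n : Type*} [Fintype n] [DecidableEq n] (M : Matrix n n R) (hM : M.det = 1) :
    M ∈ transvectionMonoid n R :=
  letI := hR.toField
  mem_transvectionMonoid_of_det_eq_one M hM

/-- The topological closure of a submonoid is a submonoid, so it suffices to approximate generators.
-/
theorem exists_norm_sub_lt_of_mem_closure {S : Type*} [NormedRing S] (G : Submonoid S) {T : Set S}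
    (hT : ∀ t ∈ T, ∀ ε > 0, ∃ g ∈ G, ‖t - g‖ < ε) {x : S} (hx : x ∈ Submonoid.closure T)
    {ε : ℝ} (hε : 0 < ε) : ∃ g ∈ G, ‖x - g‖ < ε := by
  have hle : Submonoid.closure T ≤ G.topologicalClosure :=
    Submonoid.closure_le.2 fun t ht => Metric.mem_closure_iff.2 fun ε hε => by
      simpa only [dist_eq_norm, SetLike.mem_coe] using hT t ht ε hε
  have := Metric.mem_closure_iff.1 (hle hx) ε hε
  simpa only [dist_eq_norm, SetLike.mem_coe] using this

variable {K : Type*} [NormedField K]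

/-! ### Generic radii and dominant terms. -/

section Generic

variable (K) in
/-- No nonzero power of the radius `ρ` is the norm of an element of `K`. -/
def IsGeneric (ρ : ℝ) : Prop := ∀ (x : K) (k : ℤ), k ≠ 0 → ‖x‖ ≠ ρ ^ k

/-- Up to units every nonzero element is a power of a uniformizer. Discreteness of the valuation
enters the proof only through this countability. -/
theorem countable_range_norm [IsUltrametricDist K]
    [IsDiscreteValuationRing (NormedField.valuation (K := K)).integer] :
    (Set.range (norm : K → ℝ)).Countable := by
  obtain ⟨ϖ, hϖ⟩ := IsDiscreteValuationRing.exists_irreducible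
    (NormedField.valuation (K := K)).integer
  have hmem : ∀ y : K, ‖y‖ ≤ 1 → y ∈ (NormedField.valuation (K := K)).integer := fun y hy => by
    rw [Valuation.mem_integer_iff, NormedField.valuation_apply]
    exact_mod_cast hy
  have hle : ∀ y : (NormedField.valuation (K := K)).integer, ‖(y : K)‖ ≤ 1 := fun y => by
    have h := y.2
    rw [Valuation.mem_integer_iff, NormedField.valuation_apply] at h
    exact_mod_cast h
  have hint : ∀ y : K, y ≠ 0 → ‖y‖ ≤ 1 → ∃ m : ℕ, ‖y‖ = ‖(ϖ : K)‖ ^ m := fun y hy h1 => by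
    have hy' : (⟨y, hmem y h1⟩ : (NormedField.valuation (K := K)).integer) ≠ 0 := fun h =>
      hy (congrArg Subtype.val h)
    obtain ⟨m, v, hv⟩ := IsDiscreteValuationRing.associated_pow_irreducible hy' hϖ
    have hunit : ‖((v : (NormedField.valuation (K := K)).integer) : K)‖ = 1 := by
      refine le_antisymm (hle _) ?_
      have h2 : ‖((v : (NormedField.valuation (K := K)).integer) : K)‖ *
          ‖((↑v⁻¹ : (NormedField.valuation (K := K)).integer) : K)‖ = 1 := by
        rw [← norm_mul, ← Subring.coe_mul, Units.mul_inv]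
        simp
      nlinarith [hle ↑v⁻¹, norm_nonneg ((v : (NormedField.valuation (K := K)).integer) : K)]
    refine ⟨m, ?_⟩
    have h3 := congrArg (fun z : (NormedField.valuation (K := K)).integer => ‖(z : K)‖) hv
    simpa [hunit] using h3
  refine ((Set.countable_range fun m : ℤ => ‖(ϖ : K)‖ ^ m).insert 0).mono ?_
  rintro _ ⟨y, rfl⟩
  by_cases hy : y = 0
  · exact Or.inl (by simp [hy])
  right
  rcases le_total ‖y‖ 1 with h | h
  · obtain ⟨m, hm⟩ := hint y hy h
    exact ⟨m, by simp [hm]⟩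
  · obtain ⟨m, hm⟩ := hint y⁻¹ (inv_ne_zero hy) (by rw [norm_inv]; exact inv_le_one_of_one_le₀ h)
    refine ⟨-m, ?_⟩
    rw [norm_inv] at hm
    simp [← hm]

/-- For each $k\ne 0$ the map $\rho\mapsto\rho^k$ is injective on positive reals, so only countably
many radii are bad. -/
theorem exists_isGeneric (hK : (Set.range (norm : K → ℝ)).Countable) {a b : ℝ} (ha : 0 ≤ a)
    (hab : a < b) : ∃ ρ, IsGeneric K ρ ∧ a < ρ ∧ ρ < b := by
  have hbad : (⋃ k : {k : ℤ // k ≠ 0},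
      {ρ : ℝ | 0 < ρ ∧ ρ ^ (k : ℤ) ∈ Set.range (norm : K → ℝ)}).Countable := by
    refine Set.countable_iUnion fun k => ?_
    refine Set.MapsTo.countable_of_injOn (f := fun ρ : ℝ => ρ ^ (k : ℤ)) (fun ρ hρ => hρ.2) ?_ hK
    intro ρ hρ σ hσ h
    exact zpow_left_injOn₀ k.2 hρ.1.le hσ.1.le h
  obtain ⟨ρ, hρ, hρab⟩ := (hbad.dense_compl ℝ).exists_mem_open isOpen_Ioo
    (Set.nonempty_Ioo.2 hab)
  refine ⟨ρ, fun x k hk hx => hρ ?_, hρab.1, hρab.2⟩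
  exact Set.mem_iUnion.2 ⟨⟨k, hk⟩, ha.trans_lt hρab.1, x, hx⟩

/-- The term of index `k` of the series `x` is strictly larger than all others on the circle
`|u| = ρ`. -/
def IsDominant (ρ : ℝ) (x : ℤ → K) (k : ℤ) : Prop :=
  ∀ i ≠ k, ‖x i‖ * ρ ^ i < ‖x k‖ * ρ ^ k

theorem ConvAt.exists_max {ρ : ℝ} (hρ : 0 < ρ) {x : ℤ → K} (hx : ConvAt ρ x) :
    ∃ k, ∀ i, ‖x i‖ * ρ ^ i ≤ ‖x k‖ * ρ ^ k := by
  by_cases h : ∃ j, 0 < ‖x j‖ * ρ ^ j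
  · obtain ⟨j, hj⟩ := h
    have hfin : {i : ℤ | ¬ ‖x i‖ * ρ ^ i < ‖x j‖ * ρ ^ j}.Finite := by
      have := hx.eventually (gt_mem_nhds hj)
      rwa [eventually_cofinite] at this
    obtain ⟨k, hk, hmax⟩ := Set.exists_max_image _ (fun i : ℤ => ‖x i‖ * ρ ^ i) hfin
      ⟨j, lt_irrefl _⟩
    refine ⟨k, fun i => ?_⟩
    by_cases hi : ‖x i‖ * ρ ^ i < ‖x j‖ * ρ ^ j
    · exact hi.le.trans (hmax j (lt_irrefl _))
    · exact hmax i hi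
  · push Not at h
    exact ⟨0, fun i => (h i).trans (mul_nonneg (norm_nonneg _) (zpow_pos hρ 0).le)⟩

/-- A tie between the terms of index $i$ and $k$ would give $|x_i/x_k|=\rho^{k-i}$. -/
theorem IsGeneric.exists_isDominant {ρ : ℝ} (hg : IsGeneric K ρ) (hρ : 0 < ρ) {x : ℤ → K}
    (hx : ConvAt ρ x) (h0 : x ≠ 0) : ∃ k, IsDominant ρ x k := by
  obtain ⟨k, hk⟩ := hx.exists_max hρ
  obtain ⟨j, hj⟩ := Function.ne_iff.1 h0
  have hpos : 0 < ‖x k‖ * ρ ^ k :=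
    (mul_pos (norm_pos_iff.2 hj) (zpow_pos hρ j)).trans_le (hk j)
  have hk0 : 0 < ‖x k‖ := pos_of_mul_pos_left hpos (zpow_pos hρ k).le
  refine ⟨k, fun i hi => lt_of_le_of_ne (hk i) fun h => ?_⟩
  refine hg (x i / x k) (k - i) (by omega) ?_
  rw [norm_div, zpow_sub₀ hρ.ne', div_eq_div_iff hk0.ne' (zpow_pos hρ i).ne', h, mul_comm]

theorem IsDominant.pos {ρ : ℝ} (hρ : 0 < ρ) {x : ℤ → K} {k : ℤ} (h : IsDominant ρ x k) :
    0 < ‖x k‖ := by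
  have h1 := h (k + 1) (by omega)
  exact pos_of_mul_pos_left ((mul_nonneg (norm_nonneg _) (zpow_pos hρ _).le).trans_lt h1)
    (zpow_pos hρ k).le

/-- Newton polygon monotonicity: enlarging the radius favours larger exponents. -/
theorem IsDominant.le {ρ σ : ℝ} (hρ : 0 < ρ) (hσ : ρ < σ) {x : ℤ → K} {k l : ℤ}
    (hk : IsDominant ρ x k) (hl : IsDominant σ x l) : k ≤ l := by
  by_contra! hlk
  have hσ0 := hρ.trans hσ
  have h1 := hk l hlk.ne
  have h2 := hl k hlk.ne'
  have h3 : 1 ≤ (σ / ρ) ^ (k - l) := one_le_zpow₀ ((one_le_div hρ).2 hσ.le) (by omega)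
  have e : σ ^ k * ρ ^ l = (σ / ρ) ^ (k - l) * (σ ^ l * ρ ^ k) := by
    rw [div_zpow, zpow_sub₀ hσ0.ne', zpow_sub₀ hρ.ne']
    have := (zpow_pos hρ k).ne'
    have := (zpow_pos hρ l).ne'
    have := (zpow_pos hσ0 l).ne'
    field_simp
  have hkl := hk.pos hρ
  have a1 : ‖x l‖ * ρ ^ l * σ ^ l < ‖x k‖ * ρ ^ k * σ ^ l :=
    mul_lt_mul_of_pos_right h1 (zpow_pos hσ0 l)
  have a2 : ‖x k‖ * σ ^ k * ρ ^ l < ‖x l‖ * σ ^ l * ρ ^ l :=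
    mul_lt_mul_of_pos_right h2 (zpow_pos hρ l)
  have a3 : ‖x k‖ * (σ ^ l * ρ ^ k) ≤ ‖x k‖ * (σ ^ k * ρ ^ l) := by
    rw [e]
    refine mul_le_mul_of_nonneg_left (le_mul_of_one_le_left ?_ h3) hkl.le
    exact mul_nonneg (zpow_pos hσ0 l).le (zpow_pos hρ k).le
  linarith

end Generic

theorem convAt_single (ρ : ℝ) (k : ℤ) (c : K) : ConvAt ρ (Pi.single k c : ℤ → K) := by
  refine tendsto_const_nhds.congr' ?_
  filter_upwards [(Set.finite_singleton k).eventually_cofinite_notMem] with i hi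
  rw [Set.mem_singleton_iff] at hi
  simp [hi]

/-! ### The circle ring at a generic radius is a field. -/

namespace CircleRing

variable {ρ : ℝ} [hρ : Fact (0 < ρ)]

theorem norm_lt_of_forall_lt {x : CircleRing K ρ} {C : ℝ}
    (h : ∀ i, ‖x.coeff i‖ * ρ ^ i < C) : ‖x‖ < C := by
  obtain ⟨k, hk⟩ := x.convAt.exists_max hρ.out
  exact (norm_le_iff.2 hk).trans_lt (h k)

/-- The series `c uᵏ`. -/
def monomial (k : ℤ) (c : K) : CircleRing K ρ := mk (Pi.single k c) (convAt_single ρ k c)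

variable [IsUltrametricDist K]

theorem coeff_monomial_mul (k : ℤ) (c : K) (x : CircleRing K ρ) (i : ℤ) :
    (monomial k c * x).coeff i = c * x.coeff (i - k) := by
  rw [coeff_mul, tsum_eq_single k]
  · simp [monomial]
  · intro j hj
    simp [monomial, hj]

variable [CompleteSpace K]

theorem norm_monomial_mul_sub_one_lt {x : CircleRing K ρ} {k : ℤ} (h : IsDominant ρ x.coeff k) :
    ‖monomial (-k) (x.coeff k)⁻¹ * x - 1‖ < 1 := by
  have hk := h.pos hρ.out
  refine norm_lt_of_forall_lt fun i => ?_
  rw [coeff_sub, coeff_monomial_mul, coeff_one, sub_neg_eq_add]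
  by_cases hi : i = 0
  · subst hi
    rw [zero_add, inv_mul_cancel₀ (norm_pos_iff.1 hk)]
    simp
  · have h1 := h (i + k) (by omega)
    rw [Pi.single_eq_of_ne hi, sub_zero, norm_mul, norm_inv]
    rw [zpow_add₀ hρ.out.ne', ← mul_assoc] at h1
    have h2 := lt_of_mul_lt_mul_right h1 (zpow_pos hρ.out k).le
    rw [mul_assoc, inv_mul_lt_iff₀ hk, mul_one]
    exact h2

instance : Nontrivial (CircleRing K ρ) := NormOneClass.nontrivial

/-- Dividing a nonzero series by its dominant term leaves $1$ plus an element of norm less than $1$,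
which is a unit by completeness. -/
theorem isField_of_isGeneric (hg : IsGeneric K ρ) : IsField (CircleRing K ρ) where
  exists_pair_ne := ⟨0, 1, zero_ne_one⟩
  mul_comm := mul_comm
  mul_inv_cancel := fun {x} hx => by
    have hx' : x.coeff ≠ 0 := fun h => hx (ext fun i => congrFun h i)
    obtain ⟨k, hk⟩ := hg.exists_isDominant hρ.out x.convAt hx'
    have hu := isUnit_one_add (norm_monomial_mul_sub_one_lt hk)
    rw [add_sub_cancel] at hu
    exact (isUnit_of_mul_isUnit_right hu).exists_right_inv

theorem dominant_add_eq_zero {x y : CircleRing K ρ} (hxy : x * y = 1) {k l : ℤ}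
    (hk : IsDominant ρ x.coeff k) (hl : IsDominant ρ y.coeff l) : k + l = 0 := by
  by_contra hkl
  have h1 := norm_monomial_mul_sub_one_lt hk
  have h2 := norm_monomial_mul_sub_one_lt hl
  set m : CircleRing K ρ := monomial (-k) (x.coeff k)⁻¹
  set m' : CircleRing K ρ := monomial (-l) (y.coeff l)⁻¹ with hm'
  have h3 : ‖m * m' - 1‖ < 1 := by
    have e : m * m' = (1 + (m * x - 1)) * (1 + (m' * y - 1)) := by
      calc m * m' = m * m' * (x * y) := by rw [hxy, mul_one]
        _ = _ := by ring
    rw [e]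
    exact (norm_mul_one_add_sub_one_le (max_lt h1 h2).le (le_max_left _ _)
      (le_max_right _ _)).trans_lt (max_lt h1 h2)
  -- A monomial of nonzero degree has no constant term, so it cannot be within distance less than
  -- $1$ of the unit element.
  have h4 : (m * m').coeff 0 = 0 := by
    rw [coeff_monomial_mul, hm', monomial, coeff_mk, Pi.single_eq_of_ne (by omega), mul_zero]
  have h5 := (norm_coeff_mul_le (m * m' - 1) 0).trans_lt h3
  rw [coeff_sub, h4, coeff_one] at h5
  simp at h5

end CircleRing

end Robba

/-! ### Units of the Robba ring are bounded. -/

namespace Robba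

open RobbaRing (gammaAn gammaAnU gammaCon gammaConInv)

variable {K : Type*} [NormedField K] [IsUltrametricDist K] [CompleteSpace K]

theorem mem_gammaConInv_of_bounded {p : ℕ} [Fact p.Prime] (hp : ‖(p : K)‖ = (p : ℝ)⁻¹)
    {x : RobbaRing K} {C : ℝ} (hx : ∀ i, ‖x.coeff i‖ ≤ C) : x ∈ gammaConInv K p := by
  obtain ⟨m, hm⟩ := pow_unbounded_of_one_lt C (one_lt_prime p)
  refine ⟨m, fun i => ?_⟩
  have hp0 : (0 : ℝ) < (p : ℝ) ^ m := pow_pos (zero_lt_one.trans (one_lt_prime p)) m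
  have e : ((p : RobbaRing K) ^ m * x).coeff i = (p : K) ^ m * x.coeff i := by
    rw [← Nat.cast_pow, ← nsmul_eq_mul, ← Nat.cast_pow, ← nsmul_eq_mul]
    exact map_nsmul (⟨⟨fun x => x.coeff i, rfl⟩, fun _ _ => rfl⟩ : RobbaRing K →+ K) _ x
  rw [e, norm_mul, norm_pow, hp, inv_pow, inv_mul_le_iff₀ hp0, mul_one]
  exact (hx i).trans hm.le

omit [IsUltrametricDist K] [CompleteSpace K] in
theorem frequently_isGeneric (hK : (Set.range (norm : K → ℝ)).Countable) :
    ∃ᶠ σ in 𝓝[<] (1 : ℝ), IsGeneric K σ := by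
  rw [(nhdsLT_basis (1 : ℝ)).frequently_iff]
  intro a ha
  obtain ⟨σ, hσ, h1, h2⟩ := exists_isGeneric hK (le_max_right a 0) (max_lt ha zero_lt_one)
  exact ⟨σ, ⟨(le_max_left a 0).trans_lt h1, h2⟩, hσ⟩

omit [IsUltrametricDist K] [CompleteSpace K] in
theorem exists_convAt (x : RobbaRing K) :
    ∃ η : ℝ, 0 < η ∧ η < 1 ∧ ∀ ρ : ℝ, η ≤ ρ → ρ < 1 → ConvAt ρ x.coeff := x.2

/-- The units of the Robba ring have bounded coefficients. -/
theorem exists_bound_of_mul_eq_one (hK : (Set.range (norm : K → ℝ)).Countable)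
    {x y : RobbaRing K} (hxy : x * y = 1) : ∃ C, ∀ i, ‖x.coeff i‖ ≤ C := by
  obtain ⟨η, hη0, hη1, hx⟩ := exists_convAt x
  obtain ⟨θ, hθ0, hθ1, hy⟩ := exists_convAt y
  have hone : (1 : RobbaRing K) ≠ 0 := fun h => by
    have := congrArg (RobbaRing.coeff · 0) h
    simp [RobbaRing.coeff_one, RobbaRing.coeff_zero] at this
  have hx0 : x.coeff ≠ 0 := fun h => hone (by
    rw [← hxy, show x = 0 from RobbaRing.ext fun i => congrFun h i, zero_mul])
  have hy0 : y.coeff ≠ 0 := fun h => hone (by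
    rw [← hxy, show y = 0 from RobbaRing.ext fun i => congrFun h i, mul_zero])
  have key : ∀ σ, max η θ < σ → σ < 1 → IsGeneric K σ →
      ∃ k, IsDominant σ x.coeff k ∧ IsDominant σ y.coeff (-k) := fun σ hσ hσ1 hg => by
    have hσ0 : 0 < σ := hη0.trans ((le_max_left _ _).trans_lt hσ)
    have : Fact (0 < σ) := ⟨hσ0⟩
    have hxσ := hx σ ((le_max_left _ _).trans hσ.le) hσ1
    have hyσ := hy σ ((le_max_right _ _).trans hσ.le) hσ1
    obtain ⟨k, hk⟩ := hg.exists_isDominant hσ0 hxσ hx0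
    obtain ⟨l, hl⟩ := hg.exists_isDominant hσ0 hyσ hy0
    have h1 : CircleRing.mk x.coeff hxσ * CircleRing.mk y.coeff hyσ = 1 :=
      CircleRing.ext fun i => congrArg (RobbaRing.coeff · i) hxy
    have hkl := CircleRing.dominant_add_eq_zero h1 hk hl
    refine ⟨k, hk, ?_⟩
    rwa [show -k = l by omega]
  obtain ⟨ρ, hρg, hρ, hρ1⟩ := exists_isGeneric hK (hη0.le.trans (le_max_left η θ))
    (max_lt hη1 hθ1)
  have hρ0 : 0 < ρ := hη0.trans ((le_max_left _ _).trans_lt hρ)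
  obtain ⟨k, hk, hk'⟩ := key ρ hρ hρ1 hρg
  refine ⟨‖x.coeff k‖, fun i => ?_⟩
  have hlim : ∀ j : ℤ, Tendsto (fun σ : ℝ => ‖x.coeff j‖ * σ ^ j) (𝓝[<] 1) (𝓝 ‖x.coeff j‖) :=
    fun j => by
      have h := ((continuousAt_zpow₀ (1 : ℝ) j (Or.inl one_ne_zero)).tendsto.const_mul
        ‖x.coeff j‖).mono_left (nhdsWithin_le_nhds (s := Set.Iio 1))
      simpa using h
  refine le_of_tendsto_of_tendsto_of_frequently (hlim i) (hlim k) ?_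
  refine ((frequently_isGeneric hK).and_eventually (Ioo_mem_nhdsLT hρ1)).mono ?_
  rintro σ ⟨hσg, hσρ, hσ1⟩
  obtain ⟨l, hl, hl'⟩ := key σ (hρ.trans hσρ) hσ1 hσg
  -- The dominant index of $x$ and its negative, which is the dominant index of $y$, are both
  -- nondecreasing in the radius. Hence the index is constant, and letting $\sigma\to1$ through
  -- generic radii gives $|x_i|\le|x_k|$.
  have h1 := hk.le hρ0 hσρ hl
  have h2 := hk'.le hρ0 hσρ hl'
  obtain rfl : k = l := by omega
  by_cases hi : i = k
  · rw [hi]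
  · exact (hl i hi).le

theorem mem_gammaConInv_of_mul_eq_one {p : ℕ} [Fact p.Prime] (hp : ‖(p : K)‖ = (p : ℝ)⁻¹)
    (hK : (Set.range (norm : K → ℝ)).Countable) {x y : RobbaRing K} (hxy : x * y = 1) :
    x ∈ gammaConInv K p := by
  obtain ⟨C, hC⟩ := exists_bound_of_mul_eq_one hK hxy
  exact mem_gammaConInv_of_bounded hp hC

/-! ### Approximation on the circle and factorization of arbitrary invertible matrices. -/

section Approximation

attribute [local instance] matrixNormedRing

variable {n : ℕ}

theorem mul_entry_mem {S : Subring (RobbaRing K)} {M N : Matrix (Fin n) (Fin n) (RobbaRing K)}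
    (hM : ∀ a b, M a b ∈ S) (hN : ∀ a b, N a b ∈ S) (a b : Fin n) : (M * N) a b ∈ S := by
  rw [Matrix.mul_apply]
  exact sum_mem fun c _ => mul_mem (hM a c) (hN c b)

theorem one_entry_mem (S : Subring (RobbaRing K)) (a b : Fin n) :
    (1 : Matrix (Fin n) (Fin n) (RobbaRing K)) a b ∈ S := by
  rw [Matrix.one_apply]
  split_ifs
  · exact one_mem S
  · exact zero_mem S

theorem invertibleOver_one (S : Subring (RobbaRing K)) :
    InvertibleOver S (1 : Matrix (Fin n) (Fin n) (RobbaRing K)) :=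
  invertibleOver_iff.2 ⟨one_entry_mem S, 1, one_entry_mem S, one_mul 1, one_mul 1⟩

theorem _root_.InvertibleOver.mul {S : Subring (RobbaRing K)}
    {M N : Matrix (Fin n) (Fin n) (RobbaRing K)} (hM : InvertibleOver S M)
    (hN : InvertibleOver S N) : InvertibleOver S (M * N) := by
  obtain ⟨hM, M', hM', h1, h2⟩ := invertibleOver_iff.1 hM
  obtain ⟨hN, N', hN', h3, h4⟩ := invertibleOver_iff.1 hN
  refine invertibleOver_iff.2 ⟨mul_entry_mem hM hN, N' * M', mul_entry_mem hN' hM', ?_, ?_⟩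
  · rw [mul_assoc, ← mul_assoc N, h3, one_mul, h1]
  · rw [mul_assoc, ← mul_assoc M', h2, one_mul, h4]

theorem transvection_entry_mem {S : Subring (RobbaRing K)} (i j : Fin n) {c : RobbaRing K}
    (hc : c ∈ S) (a b : Fin n) : Matrix.transvection i j c a b ∈ S := by
  rw [Matrix.transvection, Matrix.add_apply, Matrix.single_apply]
  refine add_mem (one_entry_mem S a b) ?_
  split_ifs
  · exact hc
  · exact zero_mem S

theorem invertibleOver_transvection {S : Subring (RobbaRing K)} {i j : Fin n} (h : i ≠ j)
    {c : RobbaRing K} (hc : c ∈ S) : InvertibleOver S (Matrix.transvection i j c) :=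
  invertibleOver_iff.2 ⟨transvection_entry_mem i j hc, Matrix.transvection i j (-c),
    transvection_entry_mem i j (neg_mem hc),
    by rw [Matrix.transvection_mul_transvection_same _ _ h, add_neg_cancel, Matrix.transvection_zero],
    by rw [Matrix.transvection_mul_transvection_same _ _ h, neg_add_cancel, Matrix.transvection_zero]⟩

theorem sameCoeff_transvection {ρ : ℝ} [Fact (0 < ρ)] (i j : Fin n) {c : RobbaRing K}
    {d : CircleRing K ρ} (h : ∀ k, c.coeff k = d.coeff k) :
    SameCoeff (Matrix.transvection i j c) (Matrix.transvection i j d) := by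
  refine SameCoeff.one.add fun a b k => ?_
  rw [Matrix.single_apply, Matrix.single_apply]
  split_ifs
  · exact h k
  · rfl

omit [IsUltrametricDist K] [CompleteSpace K] in
theorem convAt_of_finite {ρ : ℝ} {x : ℤ → K} (hx : {i | x i ≠ 0}.Finite) : ConvAt ρ x := by
  refine tendsto_const_nhds.congr' ?_
  filter_upwards [hx.eventually_cofinite_notMem] with i hi
  have : x i = 0 := not_not.1 hi
  simp [this]

/-- Truncations of a series are dense on a circle. -/
theorem exists_truncation {p : ℕ} [Fact p.Prime] (hp : ‖(p : K)‖ = (p : ℝ)⁻¹) {ρ : ℝ}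
    [hρ : Fact (0 < ρ)] (c : CircleRing K ρ) {ε : ℝ} (hε : 0 < ε) :
    ∃ (x : RobbaRing K) (d : CircleRing K ρ), x ∈ gammaConInv K p ∧
      (∀ i, x.coeff i = d.coeff i) ∧ ‖c - d‖ < ε := by
  classical
  have hfin : {i : ℤ | ¬ ‖c.coeff i‖ * ρ ^ i < ε}.Finite := by
    have := c.convAt.eventually (gt_mem_nhds hε)
    rwa [eventually_cofinite] at this
  let y : ℤ → K := fun i => if ‖c.coeff i‖ * ρ ^ i < ε then 0 else c.coeff i
  have hy : {i | y i ≠ 0}.Finite := hfin.subset fun i hi h => hi (if_pos h)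
  let x : RobbaRing K := ⟨y, 1 / 2, by norm_num, by norm_num, fun _ _ _ => convAt_of_finite hy⟩
  refine ⟨x, CircleRing.mk y (convAt_of_finite hy), ?_, fun i => rfl, ?_⟩
  · obtain ⟨C, hC⟩ := (hy.image fun i => ‖y i‖).bddAbove
    refine mem_gammaConInv_of_bounded hp (C := max C 0) fun i => ?_
    by_cases hi : y i = 0
    · have : x.coeff i = 0 := hi
      simp [this]
    · exact (hC ⟨i, hi, rfl⟩).trans (le_max_left _ _)
  · refine CircleRing.norm_lt_of_forall_lt fun i => ?_
    rw [CircleRing.coeff_sub, CircleRing.coeff_mk]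
    by_cases hi : ‖c.coeff i‖ * ρ ^ i < ε
    · rw [show y i = 0 from if_pos hi, sub_zero]
      exact hi
    · rw [show y i = c.coeff i from if_neg hi]
      simpa using hε

/-- The image in the circle ring of the invertible matrices over a subring of the Robba ring. -/
def invertibleImage (S : Subring (RobbaRing K)) (ρ : ℝ) [Fact (0 < ρ)] (n : ℕ) :
    Submonoid (Matrix (Fin n) (Fin n) (CircleRing K ρ)) where
  carrier := {N | ∃ M, InvertibleOver S M ∧ SameCoeff M N}
  one_mem' := ⟨1, invertibleOver_one S, SameCoeff.one⟩
  mul_mem' := by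
    rintro N N' ⟨M, hM, h⟩ ⟨M', hM', h'⟩
    exact ⟨M * M', hM.mul hM', h.mul h'⟩

/-- Truncating the entries of $N$ would not control the inverse. Truncating the parameters of
transvections does, since the inverse of a transvection only changes the sign of its parameter. -/
theorem exists_invertible_near {p : ℕ} [Fact p.Prime] (hp : ‖(p : K)‖ = (p : ℝ)⁻¹) {r : ℝ}
    [Fact (0 < (p : ℝ) ^ (-r))] (hg : IsGeneric K ((p : ℝ) ^ (-r)))
    (N : Matrix (Fin n) (Fin n) (CircleRing K ((p : ℝ) ^ (-r)))) (hN : N.det = 1) {ε : ℝ}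
    (hε : 0 < ε) :
    ∃ B B₀, InvertibleOver (gammaConInv K p ⊓ gammaAn K p r) B ∧ SameCoeff B B₀ ∧
      ‖N - B₀‖ < ε := by
  have hmem := mem_transvectionMonoid_of_isField (CircleRing.isField_of_isGeneric hg) N hN
  have hT : ∀ T ∈ {T | ∃ i j c, i ≠ j ∧ T = Matrix.transvection i j c}, ∀ ε > 0,
      ∃ g ∈ invertibleImage (gammaConInv K p ⊓ gammaAn K p r) ((p : ℝ) ^ (-r)) n,
        ‖T - g‖ < ε := by
    rintro _ ⟨i, j, c, hij, rfl⟩ ε hε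
    obtain ⟨x, d, hx, hxd, hcd⟩ := exists_truncation hp c (half_pos hε)
    have hxr : x ∈ gammaAn K p r := by
      change ConvAt _ x.coeff
      rw [funext hxd]
      exact d.convAt
    refine ⟨_, ⟨_, invertibleOver_transvection hij ⟨hx, hxr⟩, sameCoeff_transvection i j hxd⟩, ?_⟩
    refine lt_of_le_of_lt ((Matrix.norm_le_iff (half_pos hε).le).2 fun a b => ?_)
      (half_lt_self hε)
    rw [Matrix.sub_apply, Matrix.transvection, Matrix.transvection, Matrix.add_apply,
      Matrix.add_apply, add_sub_add_left_eq_sub, Matrix.single_apply, Matrix.single_apply]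
    split_ifs
    · exact hcd.le
    · simpa using (half_pos hε).le
  obtain ⟨B₀, ⟨B, hB, hBB⟩, h⟩ := exists_norm_sub_lt_of_mem_closure _ hT hmem hε
  exact ⟨B, B₀, hB, hBB, h⟩

/-- The inclusion of `Γ_{an,r}` into the ring of series on the circle `|u| = p^{-r}`. -/
def gammaAnToCircle (p : ℕ) [Fact p.Prime] (r : ℝ) [Fact (0 < (p : ℝ) ^ (-r))] :
    gammaAn K p r →+* CircleRing K ((p : ℝ) ^ (-r)) where
  toFun x := CircleRing.mk x.1.coeff x.2
  map_one' := rfl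
  map_mul' _ _ := rfl
  map_zero' := rfl
  map_add' _ _ := rfl

theorem det_toCircle_eq_one {p : ℕ} [Fact p.Prime] {r : ℝ} [Fact (0 < (p : ℝ) ^ (-r))]
    {M : Matrix (Fin n) (Fin n) (RobbaRing K)} (hM : ∀ a b, M a b ∈ gammaAn K p r)
    (hdet : M.det = 1) : (toCircle (ρ := (p : ℝ) ^ (-r)) M hM).det = 1 := by
  let M' : Matrix (Fin n) (Fin n) (gammaAn K p r) := Matrix.of fun a b => ⟨M a b, hM a b⟩
  have h1 : M'.det = 1 := (gammaAn K p r).subtype_injective <| by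
    rw [RingHom.map_det, map_one]
    exact hdet
  have h2 : (gammaAnToCircle p r).mapMatrix M' = toCircle M hM := rfl
  rw [← h2, ← RingHom.map_det, h1, map_one]

theorem det_entry_mem {S : Subring (RobbaRing K)} {M : Matrix (Fin n) (Fin n) (RobbaRing K)}
    (hM : ∀ a b, M a b ∈ S) : M.det ∈ S := by
  rw [Matrix.det_apply]
  exact sum_mem fun σ _ => zsmul_mem (prod_mem fun a _ => hM _ _) _

theorem invertibleOver_diagonal {S : Subring (RobbaRing K)} {D D' : Fin n → RobbaRing K}
    (hD : ∀ a, D a ∈ S) (hD' : ∀ a, D' a ∈ S) (h : ∀ a, D a * D' a = 1) :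
    InvertibleOver S (Matrix.diagonal D) := by
  have hmem : ∀ E : Fin n → RobbaRing K, (∀ a, E a ∈ S) → ∀ a b, Matrix.diagonal E a b ∈ S := by
    intro E hE a b
    rw [Matrix.diagonal_apply]
    split_ifs
    · exact hE a
    · exact zero_mem S
  refine invertibleOver_iff.2 ⟨hmem D hD, Matrix.diagonal D', hmem D' hD', ?_, ?_⟩
  · rw [Matrix.diagonal_mul_diagonal, ← Matrix.diagonal_one]
    exact congrArg _ (funext h)
  · rw [Matrix.diagonal_mul_diagonal, ← Matrix.diagonal_one]
    exact congrArg _ (funext fun a => (mul_comm _ _).trans (h a))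

theorem _root_.InvertibleOver.mono {S T : Subring (RobbaRing K)} (h : S ≤ T)
    {M : Matrix (Fin n) (Fin n) (RobbaRing K)} (hM : InvertibleOver S M) :
    InvertibleOver T M := by
  obtain ⟨hM, M', hM', h1, h2⟩ := invertibleOver_iff.1 hM
  exact invertibleOver_iff.2 ⟨fun a b => h (hM a b), M', fun a b => h (hM' a b), h1, h2⟩

theorem exists_generic_radius (hK : (Set.range (norm : K → ℝ)).Countable) (p : ℕ)
    [Fact p.Prime] (A A' : Matrix (Fin n) (Fin n) (RobbaRing K)) :
    ∃ r : ℝ, 0 < r ∧ IsGeneric K ((p : ℝ) ^ (-r)) ∧ (∀ a b, A a b ∈ gammaAn K p r) ∧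
      ∀ a b, A' a b ∈ gammaAn K p r := by
  have hev : ∀ x : RobbaRing K, ∀ᶠ σ in 𝓝[<] (1 : ℝ), ConvAt σ x.coeff := fun x => by
    obtain ⟨η, _, hη1, hη⟩ := exists_convAt x
    filter_upwards [Ioo_mem_nhdsLT hη1] with σ hσ
    exact hη σ hσ.1.le hσ.2
  have hall : ∀ᶠ σ in 𝓝[<] (1 : ℝ), (∀ a b, ConvAt σ (A a b).coeff) ∧
      (∀ a b, ConvAt σ (A' a b).coeff) ∧ 0 < σ ∧ σ < 1 :=
    (eventually_all.2 fun a => eventually_all.2 fun b => hev _).and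
      ((eventually_all.2 fun a => eventually_all.2 fun b => hev _).and
        (Ioo_mem_nhdsLT zero_lt_one))
  obtain ⟨σ, hg, h1, h2, hσ0, hσ1⟩ := ((frequently_isGeneric hK).and_eventually hall).exists
  have hp := one_lt_prime p
  have e : (p : ℝ) ^ (-(-Real.logb p σ)) = σ := by
    rw [neg_neg, Real.rpow_logb (zero_lt_one.trans hp) hp.ne' hσ0]
  refine ⟨-Real.logb p σ, neg_pos.2 (Real.logb_neg hp hσ0 hσ1), by rwa [e], fun a b => ?_,
    fun a b => ?_⟩
  · change ConvAt _ (A a b).coeff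
    rw [e]
    exact h1 a b
  · change ConvAt _ (A' a b).coeff
    rw [e]
    exact h2 a b

/-- A matrix of determinant `1` that is invertible over `Γ_{an,r}` for a generic radius is the
product of an invertible matrix over `Γ_{an,u}` and one over `Γ_con[1/p]`. -/
theorem exists_factorization_of_det_eq_one {p : ℕ} [Fact p.Prime]
    (hp : ‖(p : K)‖ = (p : ℝ)⁻¹) {r : ℝ} (hr : 0 < r) (hg : IsGeneric K ((p : ℝ) ^ (-r)))
    {A : Matrix (Fin n) (Fin n) (RobbaRing K)} (hA : InvertibleOver (gammaAn K p r) A)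
    (hdet : A.det = 1) :
    ∃ U V : Matrix (Fin n) (Fin n) (RobbaRing K), InvertibleOver (gammaAnU K) U ∧
      InvertibleOver (gammaConInv K p) V ∧ A = U * V := by
  have : Fact (0 < (p : ℝ) ^ (-r)) := ⟨RobbaRing.rpow_pos' p r⟩
  have hρ1 : (p : ℝ) ^ (-r) < 1 :=
    Real.rpow_lt_one_of_one_lt_of_neg (one_lt_prime p) (neg_lt_zero.2 hr)
  obtain ⟨hAm, A', hA'm, h1, h2⟩ := invertibleOver_iff.1 hA
  have hdet' : A'.det = 1 := by
    have := congrArg Matrix.det h1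
    rwa [Matrix.det_mul, hdet, one_mul, Matrix.det_one] at this
  have hA₀ := sameCoeff_toCircle (ρ := (p : ℝ) ^ (-r)) A hAm
  have hA₀' := sameCoeff_toCircle (ρ := (p : ℝ) ^ (-r)) A' hA'm
  set N := toCircle (ρ := (p : ℝ) ^ (-r)) A hAm
  set N' := toCircle (ρ := (p : ℝ) ^ (-r)) A' hA'm
  have hNN' : N * N' = 1 := (hA₀.mul hA₀').right_unique (h1 ▸ SameCoeff.one)
  -- With precision $(\|N\|+1)^{-1}$ in the approximation of $N^{-1}$, the product $NB_0$ is within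
  -- distance less than $1$ of the identity. The added $1$ avoids dividing by zero.
  have hpos : 0 < ‖N‖ + 1 := by positivity
  obtain ⟨B, B₀, hB, hBB, hnear⟩ := exists_invertible_near hp hg N'
    (det_toCircle_eq_one hA'm hdet') (inv_pos.2 hpos)
  have hlt : ‖N * B₀ - 1‖ < 1 := by
    have e : N * B₀ - 1 = -(N * (N' - B₀)) := by rw [mul_sub, hNN', neg_sub]
    rw [e, norm_neg]
    refine (norm_mul_le _ _).trans_lt ?_
    calc ‖N‖ * ‖N' - B₀‖ ≤ ‖N‖ * (‖N‖ + 1)⁻¹ :=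
          mul_le_mul_of_nonneg_left hnear.le (norm_nonneg _)
      _ < (‖N‖ + 1) * (‖N‖ + 1)⁻¹ := mul_lt_mul_of_pos_right (lt_add_one _) (inv_pos.2 hpos)
      _ = 1 := mul_inv_cancel₀ hpos.ne'
  obtain ⟨U, V, W, hUV, hVW, hWV, hUp, -, -, -, hVb, hWb, -, hinv⟩ :=
    exists_robba_factorization hρ1 (hA₀.mul hBB) hlt
  obtain ⟨hBm, B', hB'm, h3, h4⟩ := invertibleOver_iff.1 hB
  -- Inverting $U$ requires $(AB)^{-1}=B^{-1}A^{-1}$ to converge on the circle; hence $B$ was taken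
  -- invertible over the intersection with $\Gamma_{\mathrm{an},r}$.
  obtain ⟨X, hX1, hX2, hX⟩ := hinv (B' * A')
    (mul_entry_mem (S := gammaAn K p r) (fun a b => (hB'm a b).2) hA'm)
    (by rw [mul_assoc, ← mul_assoc B, h3, one_mul, h1])
    (by rw [mul_assoc, ← mul_assoc A', h2, one_mul, h4])
  refine ⟨U, V * B', invertibleOver_iff.2 ⟨coeff_eq_zero_of_sub_one hUp, X, hX, hX1, hX2⟩,
    InvertibleOver.mul ?_ ?_, ?_⟩
  · exact invertibleOver_iff.2 ⟨fun a b => mem_gammaConInv_of_norm_le_one (hVb a b), W,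
      fun a b => mem_gammaConInv_of_norm_le_one (hWb a b), hVW, hWV⟩
  · exact invertibleOver_iff.2
      ⟨fun a b => (hB'm a b).1, B, fun a b => (hBm a b).1, h4, h3⟩
  · rw [← mul_assoc, ← hUV, mul_assoc, h3, mul_one]

theorem exists_factorization_of_isUnit {p : ℕ} [Fact p.Prime] (hp : ‖(p : K)‖ = (p : ℝ)⁻¹)
    (hK : (Set.range (norm : K → ℝ)).Countable) {A : Matrix (Fin n) (Fin n) (RobbaRing K)}
    (hA : IsUnit A) :
    ∃ U V : Matrix (Fin n) (Fin n) (RobbaRing K), InvertibleOver (gammaAnU K) U ∧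
      InvertibleOver (gammaConInv K p) V ∧ A = U * V := by
  -- The determinant correction below needs a diagonal slot, so size $0$ is treated apart.
  rcases n with _ | n
  · exact ⟨1, 1, invertibleOver_one _, invertibleOver_one _, Subsingleton.elim _ _⟩
  obtain ⟨A', h1⟩ := hA.exists_right_inv
  have h2 : A' * A = 1 := mul_eq_one_comm.1 h1
  obtain ⟨r, hr, hg, hAr, hAr'⟩ := exists_generic_radius hK p A A'
  have hde : A.det * A'.det = 1 := by rw [← Matrix.det_mul, h1, Matrix.det_one]
  have hed : A'.det * A.det = 1 := by rw [mul_comm, hde]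
  let S := gammaConInv K p ⊓ gammaAn K p r
  have hd : A.det ∈ S := ⟨mem_gammaConInv_of_mul_eq_one hp hK hde, det_entry_mem hAr⟩
  have he : A'.det ∈ S := ⟨mem_gammaConInv_of_mul_eq_one hp hK hed, det_entry_mem hAr'⟩
  let D : RobbaRing K → Fin (n + 1) → RobbaRing K := fun c a => if a = 0 then c else 1
  have hD : ∀ c ∈ S, ∀ a, D c a ∈ S := fun c hc a => by
    dsimp only [D]
    split_ifs
    · exact hc
    · exact one_mem S
  have hDD : ∀ c d : RobbaRing K, c * d = 1 → ∀ a, D c a * D d a = 1 := fun c d h a => by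
    dsimp only [D]
    split_ifs
    · exact h
    · exact one_mul 1
  -- Right multiplication by $\mathrm{diag}(\det A^{-1},1,\dots,1)$ brings the determinant to $1$.
  -- Its inverse is over $\Gamma_{\mathrm{con}}[1/p]$ and is absorbed into $V$.
  have hQ : InvertibleOver S (Matrix.diagonal (D A'.det)) :=
    invertibleOver_diagonal (hD _ he) (hD _ hd) (hDD _ _ hed)
  have hQ' : InvertibleOver S (Matrix.diagonal (D A.det)) :=
    invertibleOver_diagonal (hD _ hd) (hD _ he) (hDD _ _ hde)
  have hQQ' : Matrix.diagonal (D A'.det) * Matrix.diagonal (D A.det) = 1 := by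
    rw [Matrix.diagonal_mul_diagonal, ← Matrix.diagonal_one]
    exact congrArg _ (funext (hDD _ _ hed))
  obtain ⟨U, V, hU, hV, hUV⟩ := exists_factorization_of_det_eq_one hp hr hg
    ((invertibleOver_iff.2 ⟨hAr, A', hAr', h1, h2⟩ : InvertibleOver (gammaAn K p r) A).mul
      (hQ.mono inf_le_right))
    (by rw [Matrix.det_mul, Matrix.det_diagonal]; simpa [D] using hde)
  refine ⟨U, V * Matrix.diagonal (D A.det), hU, hV.mul (hQ'.mono inf_le_left), ?_⟩
  rw [← mul_assoc, ← hUV, mul_assoc, hQQ', mul_one]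

end Approximation

end Robba

end

theorem mainTheorem9 (p : ℕ) [Fact p.Prime]
    {K : Type*} [NormedField K] [IsUltrametricDist K] [CompleteSpace K]
    [IsDiscreteValuationRing (NormedField.valuation (K := K)).integer]
    (hp : ‖(p : K)‖ = (p : ℝ)⁻¹)
    {n : ℕ} (A : Matrix (Fin n) (Fin n) (RobbaRing K)) (hA : IsUnit A) :
    (∃ U V : Matrix (Fin n) (Fin n) (RobbaRing K),
      InvertibleOver (RobbaRing.gammaAnU K) U ∧
      InvertibleOver (RobbaRing.gammaConInv K p) V ∧
      A = U * V) ∧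
    ∀ r : ℝ, 0 < r → (∀ a b, A a b ∈ RobbaRing.gammaAn K p r) →
      0 < naiveValMatrix p r (A - 1) →
      ∃ U V : Matrix (Fin n) (Fin n) (RobbaRing K),
        IsNormalizedFactorization p r A U V ∧
        (∀ U' V' : Matrix (Fin n) (Fin n) (RobbaRing K),
          IsNormalizedFactorization p r A U' V' → U' = U ∧ V' = V) ∧
        (∀ a b, V a b ∈ RobbaRing.gammaAn K p r) ∧
        InvertibleOver (RobbaRing.gammaConInv K p) V ∧
        (InvertibleOver (RobbaRing.gammaAn K p r) A →
          InvertibleOver (RobbaRing.gammaAnU K) U) ∧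
        naiveValMatrix p r (A - 1) ≤
          min (naiveValMatrix p r (U - 1)) (naiveValMatrix p r (V - 1)) := by
  exact ⟨Robba.exists_factorization_of_isUnit hp Robba.countable_range_norm hA,
    fun r hr hAr hA1 => Robba.exists_normalized_factorization hr hAr hA1⟩
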